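/- **Setting.** A judgment on an agenda of $m$ issues is an element of $\{0,1\}^m$; for a propositional formula $\Gamma$ over the issues (connectives $\neg,\wedge,\vee,\to$), a judgment is rational if it satisfies $\Gamma$. The Hamming graph $G^h$ has all of $\{0,1\}^m$ as vertices, two judgments being adjacent iff they differ on exactly one issue; $d$ is its path distance. A profile is a list $P=(P[1],\dots,P[n])$ of rational judgments, one for each agent, with set of judgments (support) $\{P\}$; it is unanimous if $\{P\}=\{J\}$ for a rational judgment $J$. The hull $\mathrm{CH}(P)$ is the smallest set of vertices that contains $\{P\}$ and every shortest path between two of its elements. The interval between two judgments consists of all vertices on shortest paths between them. $P$ is $1$-connected if, for any agents $i,j$, there is a sequence of rational judgments in the interval between $P[i]$ and $P[j]$ that leads from $P[i]$ to $P[j]$, consecutive ones being at distance at most $1$. $P$ is equidistant if $d(P[i],P[j])=d(P[i],P[r])$ for all pairwise distinct agents $i,j,r$. Put $D(i,J,P)=\sum_{j\ne i}d(J,P[j])$. **Algorithm 2**, from $P_0=P^0$. In each iteration all agents act simultaneously. Agent $i$ considers the rational judgments $J\in\mathrm{CH}(P_t)$ with $d(J,P_t[i])=1$ and $D(i,J,P_t)<D(i,P_t[i],P_t)$.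 If there are any, she moves to one of those among them for which $D(i,J,P_t)$ is least (an arbitrary one in case of a tie); otherwise she stays. This gives $P_{t+1}$. The algorithm stops at the first $t$ at which $P_t$ is unanimous, returning $P_t$, or $\{P_t\}=\{P_{t'}\}$ for some $t'<t$; in the latter case (with $P_t$ not unanimous) it chooses an arbitrary $J\in\{P_t\}$ and returns the profile $P_{t+1}$ in which every agent has $J$. **Theorem.** There are a deterministic random access program (unit cost, with addition, truncated subtraction and indirect addressing, without multiplication, which reads the outcomes of the arbitrary selections of Algorithm 2 from an external choice sequence $\omega$) and a polynomial $p$ such that the following holds for all $m$, all $\Gamma$, every odd $n>3$ and every $1$-connected, non-equidistant profile $P^0$ of $n$ rational judgments, where $s$ is the length of the encoding of $(n,m,\Gamma,P^0)$ as a list of numbers. 1. Every execution of Algorithm 2 from $P^0$ on $G^h$, whatever is selected, can be continued until the algorithm stops, and it has at most $p(s)$ profiles before the final choice (if there is one). 2. Every complete execution returns a unanimous profile, i.e. reaches consensus. 3. For every choice sequence $\omega$, the program on input $(n,m,\Gamma,P^0)$ halts after at most $p(s)$ elementary operations and outputs the list of all profiles of a complete execution of Algorithm 2 from $P^0$. Every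 complete execution is obtained in this way for some $\omega$. In short: Algorithm 2 reaches consensus from $P^0$ on $G^h$ in deterministic polynomial time. -/

import Mathlib

namespace JudgAgg

/-! ### Judgments, constraints, profiles -/

/-- Judgments on the agenda with issues `Fin m`. -/
abbrev Judgment (m : ℕ) := Fin m → Bool

/-- Profiles of `n` agents. -/
abbrev Profile (n m : ℕ) := Fin n → Judgment m

/-- Propositional formulas over the issues of the agenda. -/
inductive Formula (m : ℕ) : Type
  | var (φ : Fin m) : Formula m
  | neg (A : Formula m) : Formula m
  | and (A B : Formula m) : Formula m
  | or (A B : Formula m) : Formula m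
  | imp (A B : Formula m) : Formula m

/-- Classical truth value of a formula under a judgment. -/
def Formula.eval {m : ℕ} (J : Judgment m) : Formula m → Bool
  | .var φ => J φ
  | .neg A => !(A.eval J)
  | .and A B => A.eval J && B.eval J
  | .or A B => A.eval J || B.eval J
  | .imp A B => !(A.eval J) || B.eval J

/-- The rational judgments for the constraint `Γ`. -/
def rational {m : ℕ} (Γ : Formula m) : Set (Judgment m) := {J | Γ.eval J = true}

/-! ### Agenda graphs -/

/-- The Hamming graph: all judgments, with an edge when they differ on exactly one issue. -/
def hammingGraph (m : ℕ) : SimpleGraph (Judgment m) where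
  Adj J K := hammingDist J K = 1
  symm := ⟨fun J K h => by rwa [hammingDist_comm]⟩
  loopless := ⟨fun J h => by simp at h⟩

/-- All vertices on all shortest paths from `a` to `b`. -/
def interval {V : Type} (G : SimpleGraph V) (a b : V) : Set V :=
  {c | ∃ w : G.Walk a b, w.length = G.dist a b ∧ c ∈ w.support}

/-- The smallest set that contains `S` and all shortest paths between its own elements. -/
def geodHull {V : Type} (G : SimpleGraph V) (S : Set V) : Set V :=
  ⋂₀ {C | S ⊆ C ∧ ∀ a ∈ C, ∀ b ∈ C, interval G a b ⊆ C}

/-- `P` is `ε`-connected: for every two agents, one can get from the judgment of the one to that of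
the other through rational judgments in the interval between them, in jumps of path distance at
most `ε`. -/
def EpsConnected {n m : ℕ} (G : SimpleGraph (Judgment m)) (R : Set (Judgment m)) (ε : ℕ)
    (P : Profile n m) : Prop :=
  ∀ i j, Relation.ReflTransGen
    (fun J K => J ∈ interval G (P i) (P j) ∩ R ∧ K ∈ interval G (P i) (P j) ∩ R ∧ G.dist J K ≤ ε)
    (P i) (P j)

/-- `P` is equidistant. -/
def Equidistant {n m : ℕ} (G : SimpleGraph (Judgment m)) (P : Profile n m) : Prop :=
  ∀ i j r, i ≠ j → i ≠ r → j ≠ r → G.dist (P i) (P j) = G.dist (P i) (P r)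

/-- `{P} = {J}` for some rational `J`. -/
def Unanimous {n m : ℕ} (R : Set (Judgment m)) (P : Profile n m) : Prop :=
  ∃ J ∈ R, Set.range P = {J}

/-! ### The iteration algorithm -/

/-- The distance of `J` to the judgments of the agents other than `i`. -/
noncomputable def distOthers {n m : ℕ} (G : SimpleGraph (Judgment m)) (P : Profile n m) (i : Fin n)
    (J : Judgment m) : ℕ :=
  ∑ j ∈ Finset.univ.erase i, G.dist J (P j)

/-- The rational neighbours, within the hull, of the judgment of agent `i` that are strictly closer
to the other agents. -/
def improving {n m : ℕ} (G : SimpleGraph (Judgment m)) (R : Set (Judgment m)) (P : Profile n m)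
    (i : Fin n) : Set (Judgment m) :=
  {J | J ∈ geodHull G (Set.range P) ∩ R ∧ 0 < G.dist J (P i) ∧ G.dist J (P i) ≤ 1 ∧
    distOthers G P i J < distOthers G P i (P i)}

/-- The moves of agent `i`: the improving neighbours at the least distance to the other agents. -/
def moves {n m : ℕ} (G : SimpleGraph (Judgment m)) (R : Set (Judgment m)) (P : Profile n m)
    (i : Fin n) : Set (Judgment m) :=
  {J | J ∈ improving G R P i ∧ ∀ K ∈ improving G R P i, distOthers G P i J ≤ distOthers G P i K}

/-- One iteration: simultaneously, every agent that has a move selects one, the others stay. -/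
def Step {n m : ℕ} (G : SimpleGraph (Judgment m)) (R : Set (Judgment m)) (P Q : Profile n m) :
    Prop :=
  ∀ i, ((moves G R P i).Nonempty ∧ Q i ∈ moves G R P i) ∨ (moves G R P i = ∅ ∧ Q i = P i)

/-- The support of the current profile `P` occurred among the earlier profiles `h`. -/
def Repeats {n m : ℕ} (P : Profile n m) (h : List (Profile n m)) : Prop :=
  ∃ P' ∈ h, Set.range P = Set.range P'

/-- The partial executions of Algorithm 2 from `P₀`, before a final choice: the lists
`[P_t, …, P_1, P_0]` (latest profile first). The iteration goes on as long as the current profile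
is not unanimous and has not the same support as an earlier one. -/
inductive PartialExec {n m : ℕ} (G : SimpleGraph (Judgment m)) (R : Set (Judgment m))
    (P₀ : Profile n m) : List (Profile n m) → Prop
  | start : PartialExec G R P₀ [P₀]
  | step {P Q : Profile n m} {h : List (Profile n m)} :
      PartialExec G R P₀ (P :: h) → ¬ Unanimous R P → ¬ Repeats P h → Step G R P Q →
      PartialExec G R P₀ (Q :: P :: h)

/-- The complete executions of Algorithm 2 from `P₀` (latest profile first). The algorithm returns
a unanimous profile; when the support of a profile repeats, it chooses a judgment `J` of that
profile and returns the profile in which all agents have `J`. -/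
inductive CompleteExec {n m : ℕ} (G : SimpleGraph (Judgment m)) (R : Set (Judgment m))
    (P₀ : Profile n m) : List (Profile n m) → Prop
  | unanimous {P : Profile n m} {h : List (Profile n m)} :
      PartialExec G R P₀ (P :: h) → Unanimous R P → CompleteExec G R P₀ (P :: h)
  | choice {P : Profile n m} {h : List (Profile n m)} {J : Judgment m} :
      PartialExec G R P₀ (P :: h) → ¬ Unanimous R P → Repeats P h → J ∈ Set.range P →
      CompleteExec G R P₀ ((fun _ => J) :: P :: h)

/-- The profile returned by the execution `ρ` is unanimous. -/
def ReachesConsensus {n m : ℕ} (R : Set (Judgment m)) (ρ : List (Profile n m)) : Prop :=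
  ∃ P h, ρ = P :: h ∧ Unanimous R P

/-! ### Random access machines

Programs over finitely many registers and a memory of natural numbers, with addition, truncated
subtraction and indirect addressing at unit cost. There is no multiplication, so that a value at
most doubles with each elementary operation and the unit-cost measure is polynomially equivalent
to the time of deterministic Turing machines. -/

inductive Expr : Type
  | const (c : ℕ) : Expr
  | reg (x : ℕ) : Expr
  | mem (e : Expr) : Expr
  | add (e f : Expr) : Expr
  | sub (e f : Expr) : Expr

inductive Prog : Type
  | skip : Prog
  /-- register `x` := `e` -/
  | assign (x : ℕ) (e : Expr) : Prog
  /-- memory cell `a` := `e` -/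
  | store (a e : Expr) : Prog
  /-- register `x` := the external choice number `a` among `0, …, e - 1` -/
  | pick (x : ℕ) (a e : Expr) : Prog
  /-- append `e` to the output -/
  | emit (e : Expr) : Prog
  | seq (p q : Prog) : Prog
  /-- if `e ≠ 0` then `p` else `q` -/
  | ite (e : Expr) (p q : Prog) : Prog
  /-- while `e ≠ 0` do `p` -/
  | loop (e : Expr) (p : Prog) : Prog

structure Config : Type where
  reg : ℕ → ℕ
  mem : ℕ → ℕ
  out : List ℕ

def Expr.eval (s : Config) : Expr → ℕ
  | .const c => c
  | .reg x => s.reg x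
  | .mem e => s.mem (e.eval s)
  | .add e f => e.eval s + f.eval s
  | .sub e f => e.eval s - f.eval s

/-- The number of elementary operations in the evaluation of an expression. -/
def Expr.cost : Expr → ℕ
  | .const _ => 1
  | .reg _ => 1
  | .mem e => e.cost + 1
  | .add e f => e.cost + f.cost + 1
  | .sub e f => e.cost + f.cost + 1

/-- The external choice number `a` among `0, …, k - 1`, as given by `ω` (it is `0` if `k = 0`). -/
def answer (ω : ℕ → ℕ) (a k : ℕ) : ℕ := if k = 0 then 0 else ω a % k

/-- `Exec ω p s s' c`: when the external choices are given by `ω`, the program `p`, started in `s`,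
halts in `s'` after `c` elementary operations. For each `ω` the computation is deterministic. -/
inductive Exec (ω : ℕ → ℕ) : Prog → Config → Config → ℕ → Prop
  | skip (s : Config) : Exec ω .skip s s 1
  | assign (x : ℕ) (e : Expr) (s : Config) :
      Exec ω (.assign x e) s { s with reg := Function.update s.reg x (e.eval s) } (e.cost + 1)
  | store (a e : Expr) (s : Config) :
      Exec ω (.store a e) s { s with mem := Function.update s.mem (a.eval s) (e.eval s) }
        (a.cost + e.cost + 1)
  | pick (x : ℕ) (a e : Expr) (s : Config) :
      Exec ω (.pick x a e) s
        { s with reg := Function.update s.reg x (answer ω (a.eval s) (e.eval s)) }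
        (a.cost + e.cost + 1)
  | emit (e : Expr) (s : Config) :
      Exec ω (.emit e) s { s with out := s.out ++ [e.eval s] } (e.cost + 1)
  | seq {p q : Prog} {s s' s'' : Config} {c d : ℕ} :
      Exec ω p s s' c → Exec ω q s' s'' d → Exec ω (.seq p q) s s'' (c + d + 1)
  | ite_true {e : Expr} {p q : Prog} {s s' : Config} {c : ℕ} :
      e.eval s ≠ 0 → Exec ω p s s' c → Exec ω (.ite e p q) s s' (e.cost + c + 1)
  | ite_false {e : Expr} {p q : Prog} {s s' : Config} {c : ℕ} :
      e.eval s = 0 → Exec ω q s s' c → Exec ω (.ite e p q) s s' (e.cost + c + 1)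
  | loop_stop {e : Expr} {p : Prog} {s : Config} :
      e.eval s = 0 → Exec ω (.loop e p) s s (e.cost + 1)
  | loop_next {e : Expr} {p : Prog} {s s' s'' : Config} {c d : ℕ} :
      e.eval s ≠ 0 → Exec ω p s s' c → Exec ω (.loop e p) s' s'' d →
      Exec ω (.loop e p) s s'' (e.cost + c + d + 1)

/-- The input is in the first memory cells; all else is `0`, and the output is empty. -/
def initial (input : List ℕ) : Config where
  reg := fun _ => 0
  mem := fun a => input.getD a 0
  out := []

/-- With external choices `ω`, the program halts on `input` with output `output` after at most `B`
elementary operations. -/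
def ComputesWithin (p : Prog) (ω : ℕ → ℕ) (input output : List ℕ) (B : ℕ) : Prop :=
  ∃ s c, Exec ω p (initial input) s c ∧ s.out = output ∧ c ≤ B

/-! ### Encodings -/

/-- A formula in postfix notation, one number for each symbol. -/
def Formula.code {m : ℕ} : Formula m → List ℕ
  | .var φ => [φ.val + 4]
  | .neg A => A.code ++ [0]
  | .and A B => A.code ++ B.code ++ [1]
  | .or A B => A.code ++ B.code ++ [2]
  | .imp A B => A.code ++ B.code ++ [3]

/-- The truth values of a profile, agent by agent. -/
def Profile.code {n m : ℕ} (P : Profile n m) : List ℕ :=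
  (List.finRange n).flatMap fun i => (List.finRange m).map fun φ => (P i φ).toNat

/-- The input: numbers of agents and issues, constraint, and initial profile. -/
def instanceCode {n m : ℕ} (Γ : Formula m) (P : Profile n m) : List ℕ :=
  [n, m, Γ.code.length] ++ Γ.code ++ Profile.code P

/-- The protocol of an execution (given with the latest profile first), in chronological order. -/
def execCode {n m : ℕ} (ρ : List (Profile n m)) : List ℕ :=
  ρ.reverse.flatMap Profile.code

end JudgAgg

open JudgAgg

/-!
Polynomial-time consensus for the iteration algorithm on the Hamming graph.

In the Hamming graph the path distance is the number of issues on which two judgments differ, so a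
move of an agent flips one issue. By `distOthers_flip` the effect of a flip on the distance to the
others depends only on the number of agents who share the view given up: the flip is an improvement
iff this number is at most half of all agents, and the best flips are those for which it is least.
The restriction to the hull is no restriction, because such a flip lies on a shortest path to an
agent with the other view (`mem_moves_iff`).

For an odd number of agents it follows that only holders of a minority view ever give it up. Hence
the majority on each issue is fixed throughout, and the number of pairs (agent, issue) in which the
agent is with the majority grows with every iteration that changes the profile
(`step_agreement`). An iteration that changes nothing repeats the support, so there are at most
`n * m + 2` profiles before the final choice (`PartialExec.length_le`). All judgments stay rational,
and a run that stops at a repeated support is made unanimous by the final choice, which gives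
consensus.

The executions are parametrized by choice sequences. In iteration `t`, place `t * n + i` of the
sequence names a favourite issue of agent `i`, who flips it if it is among her best flips, and
otherwise flips the first of them that she meets in a scan of the issues; place `T * n` decides the
final choice at the time `T` of stopping. Every sequence thus yields a complete execution
(`completeExec_guidedExec`), and every complete execution arises when the issues that are flipped in
it are taken as the favourites (`CompleteExec.exists_guidedExec`).

The program `mainProg` keeps all profiles in memory, one after the other, and evaluates the formula
with a stack above the latest one. It is verified with the total-correctness judgment `Runs`, whose
cost bound `Prog.costPoly` is read off the text of the program: it is a polynomial in a bound `Z`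
for the number of iterations of each loop, and for all loops the length of the input is such a bound
(`computesWithin_mainProg`).
-/

namespace JudgAgg

/-! ### Total correctness of programs, with syntactic cost bounds -/

/-- The configuration `s` with value `v` in register `x`. -/
def Config.set (s : Config) (x v : ℕ) : Config := { s with reg := Function.update s.reg x v }

/-- The configuration `s` with value `v` in memory cell `a`. -/
def Config.put (s : Config) (a v : ℕ) : Config := { s with mem := Function.update s.mem a v }

/-- The configuration `s` with `v` appended to the output. -/
def Config.push (s : Config) (v : ℕ) : Config := { s with out := s.out ++ [v] }

section ConfigLemmas
variable (s : Config) (x v r a : ℕ)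

@[simp] theorem Config.set_reg : (s.set x v).reg r = if r = x then v else s.reg r := by
  simp [Config.set, Function.update_apply]
@[simp] theorem Config.set_mem : (s.set x v).mem = s.mem := rfl
@[simp] theorem Config.set_out : (s.set x v).out = s.out := rfl
@[simp] theorem Config.put_reg : (s.put x v).reg = s.reg := rfl
@[simp] theorem Config.put_mem : (s.put x v).mem a = if a = x then v else s.mem a := by
  simp [Config.put, Function.update_apply]
@[simp] theorem Config.push_out : (s.push v).out = s.out ++ [v] := rfl

end ConfigLemmas

/-- A bound, as a polynomial in `Z`, for the cost of a program all of whose loops make at most `Z`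
iterations each time they are entered. -/
noncomputable def Prog.costPoly : Prog → Polynomial ℕ
  | .skip => 1
  | .assign _ e => Polynomial.C (e.cost + 1)
  | .store a e => Polynomial.C (a.cost + e.cost + 1)
  | .pick _ a e => Polynomial.C (a.cost + e.cost + 1)
  | .emit e => Polynomial.C (e.cost + 1)
  | .seq p q => p.costPoly + q.costPoly + 1
  | .ite e p q => Polynomial.C (e.cost + 1) + p.costPoly + q.costPoly
  | .loop e p => Polynomial.X * (Polynomial.C (e.cost + 1) + p.costPoly) + Polynomial.C (e.cost + 1)

/-- Whether register `r` is a target of some assignment or choice in the program. -/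
def Prog.writes (r : ℕ) : Prog → Bool
  | .skip => false
  | .assign x _ => r == x
  | .store _ _ => false
  | .pick x _ _ => r == x
  | .emit _ => false
  | .seq p q => p.writes r || q.writes r
  | .ite _ p q => p.writes r || q.writes r
  | .loop _ p => p.writes r

/-- Whether the program contains a store instruction. -/
def Prog.stores : Prog → Bool
  | .store _ _ => true
  | .seq p q => p.stores || q.stores
  | .ite _ p q => p.stores || q.stores
  | .loop _ p => p.stores
  | _ => false

/-- Whether the program contains an output instruction. -/
def Prog.emits : Prog → Bool
  | .emit _ => true
  | .seq p q => p.emits || q.emits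
  | .ite _ p q => p.emits || q.emits
  | .loop _ p => p.emits
  | _ => false

/-- What the text of `p` does not mention as a target is the same in `s` and `s'`. -/
structure Frame (p : Prog) (s s' : Config) : Prop where
  reg : ∀ r, p.writes r = false → s'.reg r = s.reg r
  mem : p.stores = false → s'.mem = s.mem
  out : p.emits = false → s'.out = s.out

theorem Frame.refl (p : Prog) (s : Config) : Frame p s s :=
  ⟨fun _ _ => rfl, fun _ => rfl, fun _ => rfl⟩

theorem Frame.trans {p : Prog} {s s' s'' : Config} (h : Frame p s s') (h' : Frame p s' s'') :
    Frame p s s'' :=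
  ⟨fun r hr => (h'.reg r hr).trans (h.reg r hr), fun hp => (h'.mem hp).trans (h.mem hp),
    fun hp => (h'.out hp).trans (h.out hp)⟩

/-- A frame of `p` is a frame of every program that has all the targets of `p`. -/
theorem Frame.mono {p q : Prog} {s s' : Config} (h : Frame p s s')
    (hr : ∀ r, q.writes r = false → p.writes r = false) (hm : q.stores = false → p.stores = false)
    (ho : q.emits = false → p.emits = false) : Frame q s s' :=
  ⟨fun r h' => h.reg r (hr r h'), fun h' => h.mem (hm h'), fun h' => h.out (ho h')⟩

theorem Exec.frame {ω : ℕ → ℕ} {p : Prog} {s s' : Config} {c : ℕ} (h : Exec ω p s s' c) :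
    Frame p s s' := by
  induction h with
  | skip s => exact Frame.refl _ _
  | assign x e s =>
    refine ⟨fun r hr => ?_, fun _ => rfl, fun _ => rfl⟩
    simp only [Prog.writes, beq_eq_false_iff_ne] at hr
    simp [hr]
  | store a e s => exact ⟨fun _ _ => rfl, fun h => by simp [Prog.stores] at h, fun _ => rfl⟩
  | pick x a e s =>
    refine ⟨fun r hr => ?_, fun _ => rfl, fun _ => rfl⟩
    simp only [Prog.writes, beq_eq_false_iff_ne] at hr
    simp [hr]
  | emit e s => exact ⟨fun _ _ => rfl, fun _ => rfl, fun h => by simp [Prog.emits] at h⟩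
  | seq _ _ ihp ihq =>
    refine (ihp.mono ?_ ?_ ?_).trans (ihq.mono ?_ ?_ ?_) <;>
      simp +contextual [Prog.writes, Prog.stores, Prog.emits]
  | ite_true _ _ ih =>
    refine ih.mono ?_ ?_ ?_ <;> simp +contextual [Prog.writes, Prog.stores, Prog.emits]
  | ite_false _ _ ih =>
    refine ih.mono ?_ ?_ ?_ <;> simp +contextual [Prog.writes, Prog.stores, Prog.emits]
  | loop_stop _ => exact Frame.refl _ _
  | loop_next _ _ _ ihp ihl =>
    exact (ihp.mono (q := .loop _ _) (fun _ h => h) (fun h => h) (fun h => h)).trans ihl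

/-- Total correctness: from `s`, the program halts within the cost given by its text for loops of at
most `Z` iterations, in a configuration that satisfies `Q`. -/
def Runs (ω : ℕ → ℕ) (Z : ℕ) (p : Prog) (s : Config) (Q : Config → Prop) : Prop :=
  ∃ s' c, Exec ω p s s' c ∧ c ≤ p.costPoly.eval Z ∧ Q s'

section Rules
variable {ω : ℕ → ℕ} {Z : ℕ} {p q : Prog} {s : Config} {Q Q' : Config → Prop} {e a : Expr} {x : ℕ}

theorem Runs.mono (h : Runs ω Z p s Q) (hQ : ∀ s', Frame p s s' → Q s' → Q' s') :
    Runs ω Z p s Q' := by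
  obtain ⟨s', c, h, hc, hs⟩ := h
  exact ⟨s', c, h, hc, hQ s' h.frame hs⟩

theorem Runs.skip (h : Q s) : Runs ω Z .skip s Q :=
  ⟨s, 1, .skip s, by simp [Prog.costPoly], h⟩

theorem Runs.assign (h : Q (s.set x (e.eval s))) : Runs ω Z (.assign x e) s Q :=
  ⟨_, _, .assign x e s, by simp [Prog.costPoly], h⟩

theorem Runs.store (h : Q (s.put (a.eval s) (e.eval s))) : Runs ω Z (.store a e) s Q :=
  ⟨_, _, .store a e s, by simp [Prog.costPoly], h⟩

theorem Runs.pick (h : Q (s.set x (answer ω (a.eval s) (e.eval s)))) :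
    Runs ω Z (.pick x a e) s Q :=
  ⟨_, _, .pick x a e s, by simp [Prog.costPoly], h⟩

theorem Runs.emit (h : Q (s.push (e.eval s))) : Runs ω Z (.emit e) s Q :=
  ⟨_, _, .emit e s, by simp [Prog.costPoly], h⟩

theorem Runs.seq (h : Runs ω Z p s fun s' => Runs ω Z q s' Q) : Runs ω Z (.seq p q) s Q := by
  obtain ⟨s', c, hp, hc, s'', d, hq, hd, hQ⟩ := h
  exact ⟨s'', _, .seq hp hq, by simp [Prog.costPoly]; omega, hQ⟩

theorem Runs.ite (hp : e.eval s ≠ 0 → Runs ω Z p s Q) (hq : e.eval s = 0 → Runs ω Z q s Q) :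
    Runs ω Z (.ite e p q) s Q := by
  by_cases he : e.eval s = 0
  · obtain ⟨s', c, h, hc, hs⟩ := hq he
    exact ⟨s', _, .ite_false he h, by simp [Prog.costPoly]; omega, hs⟩
  · obtain ⟨s', c, h, hc, hs⟩ := hp he
    exact ⟨s', _, .ite_true he h, by simp [Prog.costPoly]; omega, hs⟩

/-- The body `p` of a loop with guard `e` can be run `k` times in succession from `s`, with the
guard satisfied before each run, so as to end in `s'`. -/
def Iter (ω : ℕ → ℕ) (Z : ℕ) (e : Expr) (p : Prog) : ℕ → Config → Config → Prop
  | 0, s, s' => s = s'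
  | k + 1, s, s' => e.eval s ≠ 0 ∧ Runs ω Z p s fun u => Iter ω Z e p k u s'

theorem Iter.trans {j k : ℕ} {s s' s'' : Config} (h : Iter ω Z e p j s s')
    (h' : Iter ω Z e p k s' s'') : Iter ω Z e p (j + k) s s'' := by
  induction j generalizing s with
  | zero => cases h; simpa using h'
  | succ j ih =>
    rw [Nat.succ_add]
    exact ⟨h.1, h.2.mono fun u _ hu => ih hu⟩

theorem Iter.frame {k : ℕ} {s s' : Config} (h : Iter ω Z e p k s s') : Frame p s s' := by
  induction k generalizing s with
  | zero => cases h; exact Frame.refl _ _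
  | succ k ih =>
    obtain ⟨-, u, c, hu, -, hk⟩ := h
    exact hu.frame.trans (ih hk)

theorem Iter.runs_loop {k : ℕ} {s s' : Config} (h : Iter ω Z e p k s s') (hk : k ≤ Z)
    (he : e.eval s' = 0) (hQ : Q s') : Runs ω Z (.loop e p) s Q := by
  have key : ∃ c, Exec ω (.loop e p) s s' c ∧
      c ≤ k * (e.cost + 1 + p.costPoly.eval Z) + (e.cost + 1) := by
    clear hk hQ
    induction k generalizing s with
    | zero => cases h; exact ⟨_, Exec.loop_stop he, by simp⟩
    | succ k ih =>
      obtain ⟨hg, u, c, hu, hc, hi⟩ := h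
      obtain ⟨d, hd, hdc⟩ := ih hi
      exact ⟨_, .loop_next hg hu hd, by rw [Nat.succ_mul]; omega⟩
  obtain ⟨c, hc, hcb⟩ := key
  refine ⟨s', c, hc, hcb.trans ?_, hQ⟩
  have := Nat.mul_le_mul_right (e.cost + 1 + p.costPoly.eval Z) hk
  simpa [Prog.costPoly] using this

/-- The invariant rule for a loop that makes exactly `N` iterations. -/
theorem Runs.loop {N : ℕ} (hN : N ≤ Z) (I : ℕ → Config → Prop) (h0 : I 0 s)
    (hstep : ∀ k < N, ∀ u, Frame p s u → I k u → e.eval u ≠ 0 ∧ Runs ω Z p u (I (k + 1)))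
    (hend : ∀ u, Frame p s u → I N u → e.eval u = 0 ∧ Q u) : Runs ω Z (.loop e p) s Q := by
  have key : ∀ j ≤ N, ∀ u, Frame p s u → I (N - j) u →
      ∃ s', Iter ω Z e p j u s' ∧ I N s' := by
    intro j
    induction j with
    | zero => exact fun _ u _ hu => ⟨u, rfl, hu⟩
    | succ j ih =>
      intro hj u hf hu
      obtain ⟨hg, v, c, hv, hc, hi⟩ := hstep (N - (j + 1)) (by omega) u hf hu
      rw [show N - (j + 1) + 1 = N - j by omega] at hi
      obtain ⟨s', hs', hI⟩ := ih (by omega) v (hf.trans hv.frame) hi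
      exact ⟨s', ⟨hg, v, c, hv, hc, hs'⟩, hI⟩
  obtain ⟨s', hi, hI⟩ := key N le_rfl s (Frame.refl _ _) (by simpa using h0)
  have := hend s' hi.frame hI
  exact hi.runs_loop hN this.1 this.2

end Rules

/-- `for x := 0, …, y - 1 do p`, for registers `x` and `y`. -/
def Prog.upto (x y : ℕ) (p : Prog) : Prog :=
  .seq (.assign x (.const 0)) (.loop (.sub (.reg y) (.reg x))
    (.seq p (.assign x (.add (.reg x) (.const 1)))))

/-- The invariant rule for counting loops. All that the body does not change is known to be as in
the configuration in which the loop was entered. -/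
theorem Runs.upto {ω : ℕ → ℕ} {Z N : ℕ} {p : Prog} {s : Config} {Q : Config → Prop} {x y : ℕ}
    (I : ℕ → Config → Prop) (hy : s.reg y = N) (hN : N ≤ Z)
    (hx : (p.writes x || p.writes y || x == y) = false) (h0 : I 0 (s.set x 0))
    (hstep : ∀ k < N, ∀ u, Frame (Prog.upto x y p) s u → u.reg x = k → I k u →
      Runs ω Z p u fun v => I (k + 1) (v.set x (k + 1)))
    (hend : ∀ u, Frame (Prog.upto x y p) s u → I N u → Q u) :
    Runs ω Z (Prog.upto x y p) s Q := by
  simp only [Bool.or_eq_false_iff, beq_eq_false_iff_ne] at hx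
  obtain ⟨⟨hpx, hpy⟩, hxy⟩ := hx
  have hfr : ∀ u, Frame (.seq p (.assign x (.add (.reg x) (.const 1)))) (s.set x 0) u →
      Frame (Prog.upto x y p) s u := by
    intro u hu
    refine ⟨fun r hr => ?_, fun hm => ?_, fun hm => ?_⟩
    · simp only [Prog.upto, Prog.writes, Bool.or_eq_false_iff, beq_eq_false_iff_ne] at hr
      rw [hu.reg r (by simp [Prog.writes, hr])]
      simp [hr]
    · simp only [Prog.upto, Prog.stores, Bool.or_eq_false_iff] at hm
      rw [hu.mem (by simp [Prog.stores, hm])]; rfl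
    · simp only [Prog.upto, Prog.emits, Bool.or_eq_false_iff] at hm
      rw [hu.out (by simp [Prog.emits, hm])]; rfl
  have hyu : ∀ u, Frame (Prog.upto x y p) s u → u.reg y = N := by
    intro u hu
    rw [hu.reg y (by simp [Prog.upto, Prog.writes, hpy, Ne.symm hxy]), hy]
  refine Runs.seq (Runs.assign (Runs.loop hN (fun k u => u.reg x = k ∧ I k u) ?_ ?_ ?_))
  · simpa [Expr.eval] using h0
  · rintro k hk u hu ⟨hxk, hI⟩
    refine ⟨by simp [Expr.eval, hyu u (hfr u hu), hxk]; omega, Runs.seq ?_⟩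
    refine (hstep k hk u (hfr u hu) hxk hI).mono fun v hv hIv => Runs.assign ?_
    have : v.reg x = k := by rw [hv.reg x hpx, hxk]
    simpa [Expr.eval, this] using hIv
  · rintro u hu ⟨hxk, hI⟩
    exact ⟨by simp [Expr.eval, hyu u (hfr u hu), hxk], hend u (hfr u hu) hI⟩

/-! ### Distances and moves in the Hamming graph -/

section Moves
variable {n m : ℕ}

/-- The judgment `J` with the opposite view on issue `φ`. -/
def flip (J : Judgment m) (φ : Fin m) : Judgment m := Function.update J φ (!J φ)

/-- The number of agents who have the same view on issue `φ` as agent `i`, herself included. -/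
def same (P : Profile n m) (i : Fin n) (φ : Fin m) : ℕ :=
  (Finset.univ.filter fun j => P j φ = P i φ).card

theorem flip_apply (J : Judgment m) (φ ψ : Fin m) :
    flip J φ ψ = if ψ = φ then !J ψ else J ψ := by
  unfold flip
  by_cases h : ψ = φ
  · subst h; simp
  · simp [h]

theorem flip_injective (J : Judgment m) : Function.Injective (flip J) := by
  intro φ ψ h
  by_contra hne
  have := congrFun h φ
  simp [flip_apply, hne] at this

theorem hammingDist_eq_one_iff {J K : Judgment m} :
    hammingDist K J = 1 ↔ ∃ φ, K = flip J φ := by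
  unfold hammingDist
  rw [Finset.card_eq_one]
  constructor
  · rintro ⟨φ, h⟩
    refine ⟨φ, funext fun ψ => ?_⟩
    have := congrArg (ψ ∈ ·) h
    simp only [Finset.mem_filter, Finset.mem_univ, true_and, Finset.mem_singleton,
      eq_iff_iff] at this
    rw [flip_apply]
    split_ifs with hψ
    · have := this.2 hψ
      revert this; cases K ψ <;> cases J ψ <;> simp
    · by_contra h'; exact hψ (this.1 h')
  · rintro ⟨φ, rfl⟩
    refine ⟨φ, ?_⟩
    ext ψ
    by_cases h : ψ = φ <;> simp [flip_apply, h]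

theorem hammingDist_flip_self (J : Judgment m) (φ : Fin m) : hammingDist (flip J φ) J = 1 :=
  hammingDist_eq_one_iff.2 ⟨φ, rfl⟩

/-- Flipping an issue brings a judgment one step closer to the judgments with the other view, and
one step farther from those with the same view. -/
theorem hammingDist_flip (J K : Judgment m) (φ : Fin m) :
    hammingDist (flip J φ) K + (if K φ = J φ then 0 else 1) =
      hammingDist J K + if K φ = J φ then 1 else 0 := by
  have h : ∀ L : Judgment m, hammingDist L K =
      (if L φ = K φ then 0 else 1) + ∑ ψ ∈ Finset.univ.erase φ, if L ψ = K ψ then 0 else 1 := by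
    intro L
    rw [Finset.add_sum_erase _ (fun ψ => if L ψ = K ψ then 0 else 1) (Finset.mem_univ φ)]
    unfold hammingDist
    rw [Finset.card_filter]
    exact Finset.sum_congr rfl fun ψ _ => by by_cases hh : L ψ = K ψ <;> simp [hh]
  rw [h, h J, Finset.sum_congr rfl (g := fun ψ => if J ψ = K ψ then 0 else 1)
    fun ψ hψ => by rw [flip_apply, if_neg (Finset.ne_of_mem_erase hψ)]]
  rw [flip_apply, if_pos rfl]
  generalize (∑ ψ ∈ Finset.univ.erase φ, if J ψ = K ψ then 0 else 1) = S
  cases J φ <;> cases K φ <;> simp <;> omega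

theorem exists_walk_length (J K : Judgment m) :
    ∃ w : (hammingGraph m).Walk J K, w.length = hammingDist J K := by
  induction h : hammingDist J K generalizing J with
  | zero => rw [hammingDist_eq_zero] at h; subst h; exact ⟨.nil, rfl⟩
  | succ d ih =>
    have hne : J ≠ K := fun hJ => by simp [hJ] at h
    obtain ⟨φ, hφ⟩ := Function.ne_iff.1 hne
    have hf := hammingDist_flip J K φ
    rw [if_neg (Ne.symm hφ), if_neg (Ne.symm hφ)] at hf
    obtain ⟨w, hw⟩ := ih (flip J φ) (by omega)
    have hadj : (hammingGraph m).Adj J (flip J φ) := by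
      change hammingDist _ _ = 1
      rw [hammingDist_comm, hammingDist_flip_self]
    exact ⟨.cons hadj w, by simp [hw]⟩

theorem hammingDist_le_length {J K : Judgment m} (w : (hammingGraph m).Walk J K) :
    hammingDist J K ≤ w.length := by
  induction w with
  | nil => simp
  | @cons J L K h w ih =>
    have hJL : hammingDist J L = 1 := h
    have := hammingDist_triangle J L K
    simp only [SimpleGraph.Walk.length_cons]
    omega

theorem hammingGraph_dist (J K : Judgment m) : (hammingGraph m).dist J K = hammingDist J K := by
  obtain ⟨w, hw⟩ := exists_walk_length J K
  obtain ⟨w', hw'⟩ := w.reachable.exists_walk_length_eq_dist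
  exact le_antisymm (hw ▸ SimpleGraph.dist_le w) (hw' ▸ hammingDist_le_length w')

theorem flip_mem_interval {J K : Judgment m} {φ : Fin m} (h : K φ ≠ J φ) :
    flip J φ ∈ interval (hammingGraph m) J K := by
  obtain ⟨w, hw⟩ := exists_walk_length (flip J φ) K
  have hf := hammingDist_flip J K φ
  rw [if_neg h, if_neg h] at hf
  have hadj : (hammingGraph m).Adj J (flip J φ) := by
    change hammingDist _ _ = 1
    rw [hammingDist_comm, hammingDist_flip_self]
  refine ⟨.cons hadj w, ?_, by simp⟩
  rw [hammingGraph_dist, SimpleGraph.Walk.length_cons]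
  omega

/-- A flip towards another judgment of the profile does not leave the hull, because it lies on a
shortest path. -/
theorem flip_mem_geodHull {P : Profile n m} {i j : Fin n} {φ : Fin m} (h : P j φ ≠ P i φ) :
    flip (P i) φ ∈ geodHull (hammingGraph m) (Set.range P) := by
  rintro C ⟨hP, hC⟩
  exact hC _ (hP ⟨i, rfl⟩) _ (hP ⟨j, rfl⟩) (flip_mem_interval h)

theorem same_pos (P : Profile n m) (i : Fin n) (φ : Fin m) : 0 < same P i φ :=
  Finset.card_pos.2 ⟨i, by simp⟩

theorem same_add_card_ne (P : Profile n m) (i : Fin n) (φ : Fin m) :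
    same P i φ + (Finset.univ.filter fun j => P j φ ≠ P i φ).card = n := by
  have := Finset.card_filter_add_card_filter_not (s := (Finset.univ : Finset (Fin n)))
    (fun j => P j φ = P i φ)
  simpa [same] using this

/-- The effect of a flip on the distance to the other agents depends only on the number of agents
who share the view that is given up. -/
theorem distOthers_flip (P : Profile n m) (i : Fin n) (φ : Fin m) :
    distOthers (hammingGraph m) P i (flip (P i) φ) + n + 1 =
      distOthers (hammingGraph m) P i (P i) + 2 * same P i φ := by
  have hsum : ∑ j ∈ Finset.univ.erase i, (hammingDist (flip (P i) φ) (P j) +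
      if P j φ = P i φ then 0 else 1) = ∑ j ∈ Finset.univ.erase i, (hammingDist (P i) (P j) +
      if P j φ = P i φ then 1 else 0) :=
    Finset.sum_congr rfl fun j _ => hammingDist_flip _ _ _
  have h1 : (∑ j ∈ Finset.univ.erase i, if P j φ = P i φ then 1 else 0) + 1 = same P i φ := by
    rw [same, Finset.card_filter, ← Finset.sum_erase_add _ _ (Finset.mem_univ i)]
    simp
  have h0 : (∑ j ∈ Finset.univ.erase i, if P j φ = P i φ then 0 else 1) =
      (Finset.univ.filter fun j => P j φ ≠ P i φ).card := by
    rw [Finset.card_filter, ← Finset.sum_erase_add _ _ (Finset.mem_univ i)]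
    simp [ite_not]
  have hn := same_add_card_ne P i φ
  simp only [Finset.sum_add_distrib] at hsum
  simp only [distOthers, hammingGraph_dist]
  omega

theorem mem_improving_iff {Γ : Formula m} {P : Profile n m} {i : Fin n} {J : Judgment m} :
    J ∈ improving (hammingGraph m) (rational Γ) P i ↔
      ∃ φ, J = flip (P i) φ ∧ 2 * same P i φ ≤ n ∧ Γ.eval (flip (P i) φ) = true := by
  constructor
  · rintro ⟨⟨-, hR⟩, h0, h1, hd⟩
    rw [hammingGraph_dist] at h0 h1
    obtain ⟨φ, rfl⟩ := hammingDist_eq_one_iff.1 (le_antisymm h1 h0)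
    have := distOthers_flip P i φ
    exact ⟨φ, rfl, by omega, hR⟩
  · rintro ⟨φ, rfl, hs, hR⟩
    have := distOthers_flip P i φ
    have hn := same_add_card_ne P i φ
    have hp := same_pos P i φ
    obtain ⟨j, hj⟩ : (Finset.univ.filter fun j => P j φ ≠ P i φ).Nonempty :=
      Finset.card_pos.1 (by omega)
    refine ⟨⟨flip_mem_geodHull (Finset.mem_filter.1 hj).2, hR⟩, ?_, ?_, by omega⟩ <;>
      simp [hammingGraph_dist, hammingDist_flip_self]

/-- Agent `i` can improve by flipping issue `φ`. -/
def Candidate (Γ : Formula m) (P : Profile n m) (i : Fin n) (φ : Fin m) : Prop :=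
  2 * same P i φ ≤ n ∧ Γ.eval (flip (P i) φ) = true

instance (Γ : Formula m) (P : Profile n m) (i : Fin n) (φ : Fin m) :
    Decidable (Candidate Γ P i φ) := by unfold Candidate; infer_instance

/-- The moves are the flips that give up a view shared by as few agents as possible. -/
theorem mem_moves_iff {Γ : Formula m} {P : Profile n m} {i : Fin n} {J : Judgment m} :
    J ∈ moves (hammingGraph m) (rational Γ) P i ↔
      ∃ φ, J = flip (P i) φ ∧ Candidate Γ P i φ ∧
        ∀ ψ, Candidate Γ P i ψ → same P i φ ≤ same P i ψ := by
  constructor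
  · rintro ⟨hJ, hmin⟩
    obtain ⟨φ, rfl, h⟩ := mem_improving_iff.1 hJ
    refine ⟨φ, rfl, h, fun ψ hψ => ?_⟩
    have := hmin _ (mem_improving_iff.2 ⟨ψ, rfl, hψ⟩)
    have := distOthers_flip P i φ
    have := distOthers_flip P i ψ
    omega
  · rintro ⟨φ, rfl, h, hmin⟩
    refine ⟨mem_improving_iff.2 ⟨φ, rfl, h⟩, fun K hK => ?_⟩
    obtain ⟨ψ, rfl, hψ⟩ := mem_improving_iff.1 hK
    have := hmin ψ hψ
    have := distOthers_flip P i φ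
    have := distOthers_flip P i ψ
    omega

/-! ### The number of iterations -/

/-- The view of the majority on issue `φ`. -/
def majority (P : Profile n m) (φ : Fin m) : Bool :=
  decide (n < 2 * (Finset.univ.filter fun j => P j φ = true).card)

/-- The number of pairs of an agent and an issue on which she agrees with the majority. -/
def agreement (P : Profile n m) : ℕ :=
  (Finset.univ.filter fun x : Fin n × Fin m => P x.1 x.2 = majority P x.2).card

theorem agreement_le (P : Profile n m) : agreement P ≤ n * m :=
  (Finset.card_filter_le _ _).trans (by simp)

theorem eq_majority_iff (hn : Odd n) (P : Profile n m) (i : Fin n) (φ : Fin m) :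
    P i φ = majority P φ ↔ n < 2 * same P i φ := by
  have h := same_add_card_ne P i φ
  obtain ⟨k, hk⟩ := hn
  unfold majority
  unfold same at *
  cases hb : P i φ <;> simp [hb] at h ⊢
  omega

theorem step_eq_or {Γ : Formula m} {P Q : Profile n m}
    (h : Step (hammingGraph m) (rational Γ) P Q) (i : Fin n) :
    Q i = P i ∨ ∃ φ, Q i = flip (P i) φ ∧ 2 * same P i φ ≤ n := by
  rcases h i with ⟨-, hQ⟩ | ⟨-, hQ⟩
  · obtain ⟨φ, h1, h2, -⟩ := mem_moves_iff.1 hQ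
    exact .inr ⟨φ, h1, h2.1⟩
  · exact .inl hQ

/-- Nobody gives up the view of the majority. -/
theorem step_keeps_majority {Γ : Formula m} (hn : Odd n) {P Q : Profile n m}
    (h : Step (hammingGraph m) (rational Γ) P Q) {i : Fin n} {φ : Fin m}
    (hi : P i φ = majority P φ) : Q i φ = majority P φ := by
  rcases step_eq_or h i with hQ | ⟨ψ, hQ, hs⟩
  · rw [hQ, hi]
  · rw [hQ, flip_apply, if_neg, hi]
    rintro rfl
    rw [eq_majority_iff hn] at hi
    omega

theorem step_majority {Γ : Formula m} (hn : Odd n) {P Q : Profile n m}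
    (h : Step (hammingGraph m) (rational Γ) P Q) : majority Q = majority P := by
  funext φ
  have hsub : (Finset.univ.filter fun j => P j φ = majority P φ) ⊆
      Finset.univ.filter fun j => Q j φ = majority P φ := fun j hj => by
    simp only [Finset.mem_filter, Finset.mem_univ, true_and] at hj ⊢
    exact step_keeps_majority hn h hj
  have hle := Finset.card_le_card hsub
  have hc : ∀ R : Profile n m, (Finset.univ.filter fun j => R j φ = true).card +
      (Finset.univ.filter fun j => R j φ = false).card = n := fun R => by
    have := Finset.card_filter_add_card_filter_not (s := (Finset.univ : Finset (Fin n)))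
      (fun j => R j φ = true)
    simpa using this
  have hP := hc P
  have hQ := hc Q
  obtain ⟨k, hk⟩ := hn
  unfold majority at hle ⊢
  by_cases hm : n < 2 * (Finset.univ.filter fun j => P j φ = true).card
  · simp only [hm, decide_true] at hle ⊢
    rw [decide_eq_true_iff]; omega
  · simp only [hm, decide_false] at hle ⊢
    rw [decide_eq_false_iff_not]; omega

theorem step_agreement {Γ : Formula m} (hn : Odd n) {P Q : Profile n m}
    (h : Step (hammingGraph m) (rational Γ) P Q) (hne : Q ≠ P) : agreement P < agreement Q := by
  unfold agreement
  rw [step_majority hn h]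
  refine Finset.card_lt_card ((Finset.ssubset_iff_of_subset fun x hx => ?_).2 ?_)
  · simp only [Finset.mem_filter, Finset.mem_univ, true_and] at hx ⊢
    exact step_keeps_majority hn h hx
  · obtain ⟨i, hi⟩ := Function.ne_iff.1 hne
    rcases step_eq_or h i with hQ | ⟨φ, hQ, hs⟩
    · exact absurd hQ hi
    · have hP : P i φ ≠ majority P φ := fun hP => by
        rw [eq_majority_iff hn] at hP; omega
      refine ⟨(i, φ), ?_, by simpa using hP⟩
      simp only [Finset.mem_filter, Finset.mem_univ, true_and]
      rw [hQ, flip_apply, if_pos rfl]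
      revert hP; cases P i φ <;> cases majority P φ <;> simp

theorem length_le_agreement {Γ : Formula m} (hn : Odd n) {P₀ : Profile n m}
    {ρ : List (Profile n m)} (h : PartialExec (hammingGraph m) (rational Γ) P₀ ρ) :
    ∀ P h', ρ = P :: h' → ¬ Repeats P h' → h'.length ≤ agreement P := by
  induction h with
  | start => rintro P h' ⟨⟩ -; exact Nat.zero_le _
  | @step P Q h _ _ hrep hstep ih =>
    rintro _ _ ⟨⟩ hQ
    -- If nobody moved, the support of `Q` would be that of `P`.
    have hne : Q ≠ P := fun he => hQ ⟨P, by simp, by rw [he]⟩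
    have := step_agreement hn hstep hne
    have := ih P h rfl hrep
    simp only [List.length_cons]
    omega

/-- As long as no support repeats, each iteration adds to the agreement with the majority. -/
theorem PartialExec.length_le {Γ : Formula m} (hn : Odd n) {P₀ P : Profile n m}
    {h : List (Profile n m)} (hp : PartialExec (hammingGraph m) (rational Γ) P₀ (P :: h)) :
    (P :: h).length ≤ n * m + 2 := by
  cases hp with
  | start => simp
  | @step P' _ h' hp _ hrep _ =>
    have := length_le_agreement hn hp _ _ rfl hrep
    simp only [List.length_cons]
    have := agreement_le P'
    omega

theorem exists_step (G : SimpleGraph (Judgment m)) (R : Set (Judgment m)) (P : Profile n m) :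
    ∃ Q, Step G R P Q := by
  have : ∀ i, ∃ J, ((moves G R P i).Nonempty ∧ J ∈ moves G R P i) ∨
      (moves G R P i = ∅ ∧ J = P i) := by
    intro i
    rcases (moves G R P i).eq_empty_or_nonempty with h | ⟨J, hJ⟩
    · exact ⟨P i, .inr ⟨h, rfl⟩⟩
    · exact ⟨J, .inl ⟨⟨J, hJ⟩, hJ⟩⟩
  choose Q hQ using this
  exact ⟨Q, hQ⟩

theorem PartialExec.forall_mem {G : SimpleGraph (Judgment m)} {R : Set (Judgment m)}
    {P₀ : Profile n m} {ρ : List (Profile n m)} (h : PartialExec G R P₀ ρ)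
    (h0 : ∀ i, P₀ i ∈ R) : ∀ P ∈ ρ, ∀ i, P i ∈ R := by
  induction h with
  | start => simpa using h0
  | @step P Q h _ _ _ hstep ih =>
    intro P' hP' i
    rcases List.mem_cons.1 hP' with rfl | hP'
    · rcases hstep i with ⟨-, hQ⟩ | ⟨-, hQ⟩
      · exact hQ.1.1.2
      · rw [hQ]; exact ih P (by simp) i
    · exact ih P' hP' i

theorem CompleteExec.reachesConsensus {G : SimpleGraph (Judgment m)} {R : Set (Judgment m)}
    {P₀ : Profile n m} {ρ : List (Profile n m)} (h : CompleteExec G R P₀ ρ) (hn : 0 < n)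
    (h0 : ∀ i, P₀ i ∈ R) : ReachesConsensus R ρ := by
  cases h with
  | unanimous hp hu => exact ⟨_, _, rfl, hu⟩
  | choice hp _ _ hJ =>
    obtain ⟨i, rfl⟩ := hJ
    have : Nonempty (Fin n) := ⟨⟨0, hn⟩⟩
    exact ⟨_, _, rfl, _, hp.forall_mem h0 _ (by simp) i, Set.range_const⟩

end Moves

/-! ### Runs of the algorithm that are guided by a choice sequence -/

/-- Scan the numbers below a bound for a candidate with the least key, starting from a default
`b₀` with key `w`. A later candidate replaces the best one so far if its key is smaller, or if its
key is equal and it is the favourite `fav`; so the favourite wins whenever it is optimal. The result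
is the best number together with its key. -/
def scan (cand : ℕ → Prop) [DecidablePred cand] (key : ℕ → ℕ) (fav b₀ w : ℕ) : ℕ → ℕ × ℕ
  | 0 => (b₀, w)
  | k + 1 =>
    if cand k ∧ key k < (scan cand key fav b₀ w k).2 + (if k = fav then 1 else 0) then (k, key k)
    else scan cand key fav b₀ w k

theorem scan_spec {cand : ℕ → Prop} [DecidablePred cand] {key : ℕ → ℕ} {fav b₀ w : ℕ}
    (hw : ∀ k, cand k → key k < w) (N : ℕ) :
    (scan cand key fav b₀ w N = (b₀, w) ∧ ∀ k < N, ¬ cand k) ∨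
      ∃ b < N, scan cand key fav b₀ w N = (b, key b) ∧ cand b ∧
        (∀ k < N, cand k → key b ≤ key k) ∧
        (fav < N → cand fav → key fav ≤ key b → b = fav) := by
  induction N with
  | zero => left; simp [scan]
  | succ N ih =>
    rw [scan]
    rcases ih with ⟨h, hno⟩ | ⟨b, hb, h, hc, hmin, hfav⟩ <;> simp only [h]
    · by_cases hN : cand N
      · right
        have := hw N hN
        refine ⟨N, by omega, by rw [if_pos ⟨hN, by omega⟩], hN, fun k hk hck => ?_,
          fun hf hcf _ => ?_⟩
        · rcases Nat.lt_succ_iff_lt_or_eq.1 hk with hk | rfl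
          · exact absurd hck (hno k hk)
          · exact le_rfl
        · rcases Nat.lt_succ_iff_lt_or_eq.1 hf with hf | rfl
          · exact absurd hcf (hno _ hf)
          · rfl
      · left
        refine ⟨by simp [hN], fun k hk => ?_⟩
        rcases Nat.lt_succ_iff_lt_or_eq.1 hk with hk | rfl
        · exact hno k hk
        · exact hN
    · right
      split_ifs with hf hN hN
      · subst hf
        obtain ⟨hN, hlt⟩ := hN
        refine ⟨N, by omega, rfl, hN, fun k hk hck => ?_, fun _ _ _ => rfl⟩
        rcases Nat.lt_succ_iff_lt_or_eq.1 hk with hk | rfl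
        · have := hmin k hk hck; omega
        · exact le_rfl
      · subst hf
        refine ⟨b, by omega, rfl, hc, fun k hk hck => ?_, fun _ hcf hle => ?_⟩
        · rcases Nat.lt_succ_iff_lt_or_eq.1 hk with hk | rfl
          · exact hmin k hk hck
          · have : ¬ key k < key b + 1 := fun h => hN ⟨hck, h⟩
            omega
        · exact absurd ⟨hcf, by omega⟩ hN
      · obtain ⟨hN, hlt⟩ := hN
        refine ⟨N, by omega, rfl, hN, fun k hk hck => ?_, fun hf' hcf hle => ?_⟩
        · rcases Nat.lt_succ_iff_lt_or_eq.1 hk with hk | rfl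
          · have := hmin k hk hck; omega
          · exact le_rfl
        · have := hmin fav (by omega) hcf; omega
      · refine ⟨b, by omega, rfl, hc, fun k hk hck => ?_, fun hf' hcf hle => ?_⟩
        · rcases Nat.lt_succ_iff_lt_or_eq.1 hk with hk | rfl
          · exact hmin k hk hck
          · have : ¬ key k < key b + 0 := fun h => hN ⟨hck, h⟩
            omega
        · exact hfav (by omega) hcf hle

section Guided
variable {n m : ℕ}

/-- `Candidate` for an issue given as a number. -/
def cand (Γ : Formula m) (P : Profile n m) (i : Fin n) (k : ℕ) : Prop :=
  ∃ h : k < m, Candidate Γ P i ⟨k, h⟩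

instance (Γ : Formula m) (P : Profile n m) (i : Fin n) : DecidablePred (cand Γ P i) :=
  fun k => by unfold cand; infer_instance

/-- `same` for an issue given as a number. -/
def sameNat (P : Profile n m) (i : Fin n) (k : ℕ) : ℕ := if h : k < m then same P i ⟨k, h⟩ else 0

/-- The best of the first `k` issues for agent `i` to flip, with preference for the issue `fav`,
and the number of agents who share her view on it; it is `m` if there is nothing to improve. -/
def bestIssue (Γ : Formula m) (P : Profile n m) (i : Fin n) (fav : ℕ) : ℕ → ℕ × ℕ :=
  scan (cand Γ P i) (sameNat P i) fav m n

theorem bestIssue_spec (Γ : Formula m) (P : Profile n m) (i : Fin n) (fav : ℕ) :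
    ((bestIssue Γ P i fav m).1 = m ∧ ∀ φ, ¬ Candidate Γ P i φ) ∨
      ∃ φ : Fin m, (bestIssue Γ P i fav m).1 = φ ∧ Candidate Γ P i φ ∧
        (∀ ψ, Candidate Γ P i ψ → same P i φ ≤ same P i ψ) ∧
        ∀ ψ : Fin m, ψ.val = fav → Candidate Γ P i ψ → same P i ψ ≤ same P i φ → φ = ψ := by
  -- The default key `n` is worse than that of any candidate, which is positive and at most `n / 2`.
  have hw : ∀ k, cand Γ P i k → sameNat P i k < n := by
    rintro k ⟨hk, h⟩
    have := same_pos P i ⟨k, hk⟩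
    have := h.1
    simp only [sameNat, hk, dif_pos]
    omega
  rcases scan_spec (fav := fav) (b₀ := m) hw m with ⟨h, hno⟩ | ⟨b, hb, h, ⟨_, hc⟩, hmin, hfav⟩
  · left
    exact ⟨by rw [bestIssue, h], fun φ hφ => hno φ φ.2 ⟨φ.2, hφ⟩⟩
  · right
    simp only [sameNat, hb, dif_pos] at hmin hfav
    refine ⟨⟨b, hb⟩, by rw [bestIssue, h], hc, fun ψ hψ => ?_, ?_⟩
    · simpa using hmin ψ ψ.2 ⟨ψ.2, hψ⟩
    · rintro ψ rfl hψ hle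
      exact Fin.ext (hfav ψ.2 ⟨ψ.2, hψ⟩ (by simpa using hle))

/-- The profile after one iteration, in which agent `i` selects the issue `fav i` if it is among
the best ones. -/
def nextProfile (Γ : Formula m) (P : Profile n m) (fav : Fin n → ℕ) : Profile n m :=
  fun i ψ => if ψ.val = (bestIssue Γ P i (fav i) m).1 then !P i ψ else P i ψ

theorem nextProfile_of_none {Γ : Formula m} {P : Profile n m} {fav : Fin n → ℕ} {i : Fin n}
    (h : (bestIssue Γ P i (fav i) m).1 = m) : nextProfile Γ P fav i = P i := by
  funext ψ
  simp [nextProfile, h, ψ.2.ne]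

theorem nextProfile_of_some {Γ : Formula m} {P : Profile n m} {fav : Fin n → ℕ} {i : Fin n}
    {φ : Fin m} (h : (bestIssue Γ P i (fav i) m).1 = φ) :
    nextProfile Γ P fav i = flip (P i) φ := by
  funext ψ
  simp [nextProfile, h, flip_apply, Fin.ext_iff]

theorem step_nextProfile (Γ : Formula m) (P : Profile n m) (fav : Fin n → ℕ) :
    Step (hammingGraph m) (rational Γ) P (nextProfile Γ P fav) := by
  intro i
  rcases bestIssue_spec Γ P i (fav i) with ⟨h, hno⟩ | ⟨φ, h, hc, hmin, -⟩
  · right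
    refine ⟨Set.eq_empty_of_forall_notMem fun J hJ => ?_, nextProfile_of_none h⟩
    obtain ⟨φ, -, hφ, -⟩ := mem_moves_iff.1 hJ
    exact hno φ hφ
  · left
    have : nextProfile Γ P fav i ∈ moves (hammingGraph m) (rational Γ) P i :=
      mem_moves_iff.2 ⟨φ, nextProfile_of_some h, hc, hmin⟩
    exact ⟨⟨_, this⟩, this⟩

/-- Every outcome of an iteration is obtained by taking the flipped issues as favourites. -/
theorem nextProfile_eq {Γ : Formula m} {P Q : Profile n m} {fav : Fin n → ℕ}
    (hQ : Step (hammingGraph m) (rational Γ) P Q)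
    (hfav : ∀ i φ, Q i = flip (P i) φ → fav i = φ.val) : nextProfile Γ P fav = Q := by
  funext i
  rcases hQ i with ⟨-, hm⟩ | ⟨hm, hs⟩
  · obtain ⟨ψ, hψ, hcψ, hminψ⟩ := mem_moves_iff.1 hm
    rcases bestIssue_spec Γ P i (fav i) with ⟨h, hno⟩ | ⟨φ, h, hc, hmin, hf⟩
    · exact absurd hcψ (hno ψ)
    · rw [nextProfile_of_some h, hψ, hf ψ (hfav i ψ hψ).symm hcψ (hminψ φ hc)]
  · rcases bestIssue_spec Γ P i (fav i) with ⟨h, hno⟩ | ⟨φ, h, hc, hmin, hf⟩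
    · rw [nextProfile_of_none h, hs]
    · have : flip (P i) φ ∈ moves (hammingGraph m) (rational Γ) P i :=
        mem_moves_iff.2 ⟨φ, rfl, hc, hmin⟩
      rw [hm] at this
      exact this.elim

/-- The profile after `t` iterations without regard to termination, when agent `i` takes her
favourite issue in iteration `t` from place `t * n + i` of the choice sequence. -/
def trace (Γ : Formula m) (P₀ : Profile n m) (ω : ℕ → ℕ) : ℕ → Profile n m
  | 0 => P₀
  | t + 1 => nextProfile Γ (trace Γ P₀ ω t) fun i => answer ω (t * n + i) m

/-- The profiles before iteration `t`, latest first. -/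
def past (Γ : Formula m) (P₀ : Profile n m) (ω : ℕ → ℕ) (t : ℕ) : List (Profile n m) :=
  ((List.range t).map (trace Γ P₀ ω)).reverse

/-- The criterion for the algorithm to stop holds at time `t`. -/
def Stops (Γ : Formula m) (P₀ : Profile n m) (ω : ℕ → ℕ) (t : ℕ) : Prop :=
  Unanimous (rational Γ) (trace Γ P₀ ω t) ∨ Repeats (trace Γ P₀ ω t) (past Γ P₀ ω t)

/-- `T` is the time at which the algorithm stops. -/
def StopsFirst (Γ : Formula m) (P₀ : Profile n m) (ω : ℕ → ℕ) (T : ℕ) : Prop :=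
  Stops Γ P₀ ω T ∧ ∀ t < T, ¬ Stops Γ P₀ ω t

open Classical in
/-- The complete execution that is guided by `ω` and stops at time `T`; the final choice is at
place `T * n` of the choice sequence. -/
noncomputable def guidedExec (Γ : Formula m) (P₀ : Profile n m) (ω : ℕ → ℕ) (T : ℕ) (hn : 0 < n) :
    List (Profile n m) :=
  if Unanimous (rational Γ) (trace Γ P₀ ω T) then trace Γ P₀ ω T :: past Γ P₀ ω T
  else (fun _ => trace Γ P₀ ω T ⟨ω (T * n) % n, Nat.mod_lt _ hn⟩) ::
    trace Γ P₀ ω T :: past Γ P₀ ω T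

variable {Γ : Formula m} {P₀ : Profile n m} {ω : ℕ → ℕ}

theorem past_succ (t : ℕ) : past Γ P₀ ω (t + 1) = trace Γ P₀ ω t :: past Γ P₀ ω t := by
  simp [past, List.range_succ]

@[simp] theorem length_past (t : ℕ) : (past Γ P₀ ω t).length = t := by simp [past]

theorem repeats_past_iff {t : ℕ} : Repeats (trace Γ P₀ ω t) (past Γ P₀ ω t) ↔
    ∃ k < t, Set.range (trace Γ P₀ ω t) = Set.range (trace Γ P₀ ω k) := by
  simp [Repeats, past]

theorem partialExec_trace {t : ℕ} (h : ∀ k < t, ¬ Stops Γ P₀ ω k) :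
    PartialExec (hammingGraph m) (rational Γ) P₀ (trace Γ P₀ ω t :: past Γ P₀ ω t) := by
  induction t with
  | zero => exact .start
  | succ t ih =>
    have ht := h t t.lt_succ_self
    rw [Stops, not_or] at ht
    rw [past_succ]
    exact .step (ih fun k hk => h k (by omega)) ht.1 ht.2 (step_nextProfile _ _ _)

theorem StopsFirst.le (hn : Odd n) {T : ℕ} (hT : StopsFirst Γ P₀ ω T) : T ≤ n * m + 1 := by
  have := (partialExec_trace hT.2).length_le hn
  simp only [List.length_cons, length_past] at this
  omega

theorem exists_stopsFirst (hn : Odd n) (Γ : Formula m) (P₀ : Profile n m) (ω : ℕ → ℕ) :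
    ∃ T, StopsFirst Γ P₀ ω T := by
  classical
  have hex : ∃ T, Stops Γ P₀ ω T := by
    by_contra! h
    have := (partialExec_trace (t := n * m + 2) fun k _ => h k).length_le hn
    simp only [List.length_cons, length_past] at this
    omega
  exact ⟨Nat.find hex, Nat.find_spec hex, fun t ht => Nat.find_min hex ht⟩

theorem completeExec_guidedExec {T : ℕ} (hT : StopsFirst Γ P₀ ω T) (hn : 0 < n) :
    CompleteExec (hammingGraph m) (rational Γ) P₀ (guidedExec Γ P₀ ω T hn) := by
  unfold guidedExec
  split_ifs with h
  · exact .unanimous (partialExec_trace hT.2) h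
  · exact .choice (partialExec_trace hT.2) h (hT.1.resolve_left h) ⟨_, rfl⟩

/-- The first `t` iterations depend only on the first `t * n` places of the choice sequence. -/
theorem trace_congr {ω' : ℕ → ℕ} {t : ℕ} (h : ∀ a < t * n, ω a = ω' a) :
    ∀ k ≤ t, trace Γ P₀ ω k = trace Γ P₀ ω' k := by
  intro k
  induction k with
  | zero => exact fun _ => rfl
  | succ k ih =>
    intro hk
    rw [trace, trace, ih (by omega)]
    congr 1
    funext i
    have : k * n + i < t * n := by
      have := Nat.mul_le_mul_right n hk
      rw [Nat.succ_mul] at this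
      have := i.2
      omega
    rw [answer, answer, h _ this]

theorem past_congr {ω' : ℕ → ℕ} {t : ℕ} (h : ∀ a < t * n, ω a = ω' a) :
    past Γ P₀ ω t = past Γ P₀ ω' t := by
  unfold past
  congr 1
  refine List.map_congr_left fun k hk => trace_congr h k (List.mem_range.1 hk).le

/-- Every partial execution is guided by some choice sequence. -/
theorem PartialExec.exists_trace {ρ : List (Profile n m)}
    (h : PartialExec (hammingGraph m) (rational Γ) P₀ ρ) :
    ∃ ω t, ρ = trace Γ P₀ ω t :: past Γ P₀ ω t ∧ ∀ k < t, ¬ Stops Γ P₀ ω k := by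
  induction h with
  | start => exact ⟨fun _ => 0, 0, rfl, by simp⟩
  | @step P Q h hp hu hr hstep ih =>
    obtain ⟨ω, t, he, hns⟩ := ih
    obtain ⟨rfl, rfl⟩ := List.cons.inj he
    have hf : ∀ i, ∃ k : ℕ, ∀ φ : Fin m, Q i = flip (trace Γ P₀ ω t i) φ → k = φ.val := by
      intro i
      by_cases hex : ∃ φ, Q i = flip (trace Γ P₀ ω t i) φ
      · obtain ⟨φ, hφ⟩ := hex
        exact ⟨φ, fun ψ hψ => by rw [flip_injective _ (hφ.symm.trans hψ)]⟩
      · exact ⟨0, fun φ hφ => absurd ⟨φ, hφ⟩ hex⟩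
    choose f hf using hf
    -- Keep the choices of the earlier iterations and append the flipped issues.
    let ω' : ℕ → ℕ := fun a =>
      if a < t * n then ω a else if h : a - t * n < n then f ⟨a - t * n, h⟩ else 0
    have hω : ∀ a < t * n, ω a = ω' a := fun a ha => by simp [ω', ha]
    have htr := trace_congr (Γ := Γ) (P₀ := P₀) hω
    have hpast := past_congr (Γ := Γ) (P₀ := P₀) hω
    refine ⟨ω', t + 1, ?_, ?_⟩
    · rw [past_succ, ← htr t le_rfl, ← hpast, trace, ← htr t le_rfl]
      congr 1
      refine (nextProfile_eq hstep fun i φ hφ => ?_).symm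
      -- `answer` reduces modulo `m` and is `0` for `m = 0`.
      have hm : m ≠ 0 := by rintro rfl; exact φ.elim0
      have hi : ω' (t * n + i) = φ := by
        simp only [ω', Nat.not_lt.2 (Nat.le_add_right _ _), if_false, Nat.add_sub_cancel_left]
        rw [dif_pos i.2, hf i φ hφ]
      rw [answer, if_neg hm, hi, Nat.mod_eq_of_lt φ.2]
    · intro k hk
      have hωk : ∀ a < k * n, ω a = ω' a := fun a ha =>
        hω a (ha.trans_le (Nat.mul_le_mul_right n (by omega)))
      have hpk : past Γ P₀ ω k = past Γ P₀ ω' k := past_congr hωk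
      rw [Stops, ← htr k (by omega), ← hpk]
      rcases Nat.lt_succ_iff_lt_or_eq.1 hk with hk | rfl
      · exact hns k hk
      · exact not_or.2 ⟨hu, hr⟩

/-- Every complete execution is guided by some choice sequence. -/
theorem CompleteExec.exists_guidedExec {ρ : List (Profile n m)}
    (h : CompleteExec (hammingGraph m) (rational Γ) P₀ ρ) (hn : 0 < n) :
    ∃ ω T, StopsFirst Γ P₀ ω T ∧ ρ = guidedExec Γ P₀ ω T hn := by
  cases h with
  | unanimous hp hu =>
    obtain ⟨ω, T, he, hT⟩ := hp.exists_trace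
    obtain ⟨rfl, rfl⟩ := List.cons.inj he
    exact ⟨ω, T, ⟨.inl hu, hT⟩, by rw [guidedExec, if_pos hu]⟩
  | choice hp hu hr hJ =>
    obtain ⟨ω, T, he, hT⟩ := hp.exists_trace
    obtain ⟨rfl, rfl⟩ := List.cons.inj he
    obtain ⟨j, rfl⟩ := hJ
    -- The final choice is the first one after those of the `T` iterations.
    let ω' : ℕ → ℕ := fun a => if a < T * n then ω a else j
    have hω : ∀ a < T * n, ω a = ω' a := fun a ha => by simp [ω', ha]
    have htr := trace_congr (Γ := Γ) (P₀ := P₀) hω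
    have hpast := past_congr (Γ := Γ) (P₀ := P₀) hω
    refine ⟨ω', T, ⟨?_, fun k hk => ?_⟩, ?_⟩
    · right; rwa [← htr T le_rfl, ← hpast]
    · have hωk : ∀ a < k * n, ω a = ω' a := fun a ha =>
        hω a (ha.trans_le (Nat.mul_le_mul_right n hk.le))
      have hpk : past Γ P₀ ω k = past Γ P₀ ω' k := past_congr hωk
      rw [Stops, ← htr k hk.le, ← hpk]
      exact hT k hk
    · rw [guidedExec, ← htr T le_rfl, ← hpast, if_neg hu]
      congr 1
      funext _
      congr 1
      exact Fin.ext (by simp [ω', Nat.mod_eq_of_lt j.2])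

end Guided

/-! ### The program -/

/-- The distance of two numbers, by truncated subtraction. -/
def Expr.absDiff (e f : Expr) : Expr := .add (.sub e f) (.sub f e)

/-- `1` if the values are equal and `0` otherwise. -/
def Expr.isEq (e f : Expr) : Expr := .sub (.const 1) (.absDiff e f)

@[simp] theorem Expr.eval_const (s : Config) (c : ℕ) : (Expr.const c).eval s = c := rfl
@[simp] theorem Expr.eval_reg (s : Config) (x : ℕ) : (Expr.reg x).eval s = s.reg x := rfl
@[simp] theorem Expr.eval_mem (s : Config) (e : Expr) :
    (Expr.mem e).eval s = s.mem (e.eval s) := rfl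
@[simp] theorem Expr.eval_add (s : Config) (e f : Expr) :
    (Expr.add e f).eval s = e.eval s + f.eval s := rfl
@[simp] theorem Expr.eval_sub (s : Config) (e f : Expr) :
    (Expr.sub e f).eval s = e.eval s - f.eval s := rfl
@[simp] theorem Expr.eval_isEq (s : Config) (e f : Expr) :
    (Expr.isEq e f).eval s = if e.eval s = f.eval s then 1 else 0 := by
  simp only [Expr.isEq, Expr.absDiff, Expr.eval]
  split_ifs <;> omega

theorem Expr.eval_absDiff_eq_zero {s : Config} {e f : Expr} :
    (Expr.absDiff e f).eval s = 0 ↔ e.eval s = f.eval s := by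
  simp only [Expr.absDiff, Expr.eval]
  omega

/-- On truth values, the distance is the exclusive disjunction. -/
theorem Expr.eval_absDiff_toNat {s : Config} {e f : Expr} {b : Bool} {p : Prop} [Decidable p]
    (he : e.eval s = b.toNat) (hf : f.eval s = if p then 1 else 0) :
    (Expr.absDiff e f).eval s = (if p then !b else b).toNat := by
  simp only [Expr.absDiff, Expr.eval, he, hf]
  cases b <;> split_ifs <;> rfl

/-- Sequential composition of programs. -/
infixr:60 " ;; " => Prog.seq

/-- Assignment to a register. -/
infix:65 " ≔ " => Prog.assign

/-- The content of the memory cell with offset `e` from the address in a register. -/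
def cell (x : ℕ) (e : Expr) : Expr := .mem (.add (.reg x) e)

/-- Increase of a register by another one. -/
def advance (x y : ℕ) : Prog := x ≔ .add (.reg x) (.reg y)

-- The number of agents, the number of issues, their product, and the address of the initial
-- profile.
local notation "rN" => 0
local notation "rM" => 1
local notation "rNM" => 2
local notation "rBase" => 3
-- The address of the current profile, the number of iterations, the number of choices made so far,
-- and the flag that keeps the main loop going.
local notation "rCur" => 4
local notation "rT" => 5
local notation "rChoices" => 6
local notation "rGo" => 7
-- The addresses of two profiles and of two judgments that are compared, and the result.
local notation "rProfA" => 8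
local notation "rProfB" => 9
local notation "rRowA" => 10
local notation "rRowB" => 11
local notation "rDiff" => 12
-- Loop counters for issues, agents (twice) and profiles.
local notation "rIssue" => 13
local notation "rI" => 14
local notation "rJ" => 15
local notation "rH" => 16
-- Whether a judgment was found, whether one is missing, whether a support repeats, the address of
-- the earlier profile, and whether two agents differ.
local notation "rHit" => 17
local notation "rMiss" => 18
local notation "rRepeats" => 19
local notation "rOld" => 20
local notation "rSplit" => 21
-- The addresses of the judgment of the agent to move, now and after the move; her favourite issue,
-- the best issue and its key; the issue under consideration and its key; a pointer.
local notation "rRow" => 22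
local notation "rNewRow" => 23
local notation "rFav" => 24
local notation "rBest" => 25
local notation "rBestKey" => 26
local notation "rPhi" => 27
local notation "rKey" => 28
local notation "rPtr" => 29
-- The bottom of the stack, its top, the address in the formula, the symbol, and the agent to move.
local notation "rStack" => 30
local notation "rTop" => 31
local notation "rPos" => 32
local notation "rSym" => 33
local notation "rAgent" => 34

/-- Compare the judgments at `rRowA` and `rRowB`. -/
def compareRows : Prog :=
  rDiff ≔ .const 0 ;;
  .upto rIssue rM (.ite (.absDiff (cell rRowA (.reg rIssue)) (cell rRowB (.reg rIssue)))
    (rDiff ≔ .const 1) .skip)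

/-- Set `rMiss` if some judgment of the profile at `rProfA` does not occur in that at `rProfB`. -/
def checkSubset : Prog :=
  rRowA ≔ .reg rProfA ;;
  .upto rI rN
    (rHit ≔ .const 0 ;;
    rRowB ≔ .reg rProfB ;;
    .upto rJ rN
      (compareRows ;;
      .ite (.reg rDiff) .skip (rHit ≔ .const 1) ;;
      advance rRowB rM) ;;
    .ite (.reg rHit) .skip (rMiss ≔ .const 1) ;;
    advance rRowA rM)

/-- Compare the support of the current profile to those of all earlier ones. -/
def checkRepeats : Prog :=
  rRepeats ≔ .const 0 ;;
  rOld ≔ .reg rBase ;;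
  .upto rH rT
    (rMiss ≔ .const 0 ;;
    rProfA ≔ .reg rCur ;;
    rProfB ≔ .reg rOld ;;
    checkSubset ;;
    rProfA ≔ .reg rOld ;;
    rProfB ≔ .reg rCur ;;
    checkSubset ;;
    .ite (.reg rMiss) .skip (rRepeats ≔ .const 1) ;;
    advance rOld rNM)

/-- Compare all judgments of the current profile to the first one. -/
def checkUnanimous : Prog :=
  rSplit ≔ .const 0 ;;
  rRowA ≔ .reg rCur ;;
  rRowB ≔ .reg rCur ;;
  .upto rI rN
    (compareRows ;;
    .ite (.reg rDiff) (rSplit ≔ .const 1) .skip ;;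
    advance rRowB rM)

/-- Write the judgment at `rRowB` to the output. -/
def emitRow : Prog := .upto rIssue rM (.emit (cell rRowB (.reg rIssue)))

/-- Write the current profile to the output. -/
def emitProfile : Prog :=
  rRowB ≔ .reg rCur ;;
  .upto rI rN (emitRow ;; advance rRowB rM)

/-- Choose an agent and output the profile in which all agents have her judgment. -/
def finalChoice : Prog :=
  .pick rFav (.reg rChoices) (.reg rN) ;;
  rRowB ≔ .reg rCur ;;
  .upto rI rFav (advance rRowB rM) ;;
  .upto rI rN emitRow

/-- Count the agents who have the same view on issue `rPhi` as the agent at `rRow`. -/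
def countSame : Prog :=
  rKey ≔ .const 0 ;;
  rPtr ≔ .add (.reg rCur) (.reg rPhi) ;;
  .upto rJ rN
    (rKey ≔ .add (.reg rKey) (.isEq (.mem (.reg rPtr)) (cell rRow (.reg rPhi))) ;;
    advance rPtr rM)

/-- Process one symbol of the formula in postfix notation. -/
def evalSymbol : Prog :=
  rSym ≔ .mem (.reg rPos) ;;
  .ite (.sub (.reg rSym) (.const 3))
    (.store (.reg rTop) (.absDiff (cell rRow (.sub (.reg rSym) (.const 4)))
      (.isEq (.sub (.reg rSym) (.const 4)) (.reg rPhi))) ;;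
    rTop ≔ .add (.reg rTop) (.const 1))
    (.ite (.reg rSym)
      (rTop ≔ .sub (.reg rTop) (.const 1) ;;
      .ite (.sub (.reg rSym) (.const 1))
        (.ite (.sub (.reg rSym) (.const 2))
          (.store (.sub (.reg rTop) (.const 1))
            (.sub (.const 1) (.sub (.mem (.sub (.reg rTop) (.const 1))) (.mem (.reg rTop)))))
          (.store (.sub (.reg rTop) (.const 1))
            (.sub (.const 1) (.sub (.sub (.const 1) (.mem (.sub (.reg rTop) (.const 1))))
              (.mem (.reg rTop))))))
        (.store (.sub (.reg rTop) (.const 1))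
          (.sub (.add (.mem (.sub (.reg rTop) (.const 1))) (.mem (.reg rTop))) (.const 1))))
      (.store (.sub (.reg rTop) (.const 1))
        (.sub (.const 1) (.mem (.sub (.reg rTop) (.const 1)))))) ;;
  rPos ≔ .add (.reg rPos) (.const 1)

/-- Evaluate the formula under the judgment at `rRow` with issue `rPhi` flipped. -/
def evalFormula : Prog :=
  rPos ≔ .const 3 ;;
  rTop ≔ .reg rStack ;;
  .loop (.sub (.reg rBase) (.reg rPos)) evalSymbol

/-- Let issue `rPhi` replace the best one so far if it is a better candidate. -/
def considerIssue : Prog :=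
  countSame ;;
  .ite (.sub (.add (.reg rN) (.const 1)) (.add (.reg rKey) (.reg rKey)))
    (evalFormula ;;
    .ite (.mem (.reg rStack))
      (.ite (.sub (.add (.reg rBestKey) (.isEq (.reg rPhi) (.reg rFav))) (.reg rKey))
        (rBest ≔ .reg rPhi ;; rBestKey ≔ .reg rKey) .skip)
      .skip)
    .skip

/-- Compute the judgment of one agent in the next profile. -/
def moveAgent : Prog :=
  .pick rFav (.reg rChoices) (.reg rM) ;;
  rChoices ≔ .add (.reg rChoices) (.const 1) ;;
  rBest ≔ .reg rM ;;
  rBestKey ≔ .reg rN ;;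
  .upto rPhi rM considerIssue ;;
  .upto rIssue rM (.store (.add (.reg rNewRow) (.reg rIssue))
    (.absDiff (cell rRow (.reg rIssue)) (.isEq (.reg rIssue) (.reg rBest)))) ;;
  advance rRow rM ;;
  advance rNewRow rM

/-- Compute the next profile, just above the current one; the stack is above both. -/
def iteration : Prog :=
  rRow ≔ .reg rCur ;;
  rNewRow ≔ .add (.reg rCur) (.reg rNM) ;;
  rStack ≔ .add (.reg rNewRow) (.reg rNM) ;;
  .upto rAgent rN moveAgent ;;
  advance rCur rNM ;;
  rT ≔ .add (.reg rT) (.const 1)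

/-- Output the current profile, and stop or compute the next one. -/
def mainBody : Prog :=
  emitProfile ;;
  checkUnanimous ;;
  .ite (.reg rSplit)
    (checkRepeats ;;
    .ite (.reg rRepeats) (finalChoice ;; rGo ≔ .const 0) iteration)
    (rGo ≔ .const 0)

/-- The program that carries out the iteration algorithm. -/
def mainProg : Prog :=
  rN ≔ .mem (.const 0) ;;
  rM ≔ .mem (.const 1) ;;
  rBase ≔ .add (.const 3) (.mem (.const 2)) ;;
  rNM ≔ .const 0 ;;
  .upto rI rN (advance rNM rM) ;;
  rCur ≔ .reg rBase ;;
  rGo ≔ .const 1 ;;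
  .loop (.reg rGo) mainBody

/-! ### Comparison of judgments and profiles -/

section Specs
variable {n m Z : ℕ} {ω : ℕ → ℕ} {s : Config}

/-- The judgment `J` is stored at address `a`. -/
def RowAt (mem : ℕ → ℕ) (a : ℕ) (J : Judgment m) : Prop :=
  ∀ φ : Fin m, mem (a + φ) = (J φ).toNat

/-- The profile `P` is stored at address `a`, agent by agent. -/
def ProfileAt (mem : ℕ → ℕ) (a : ℕ) (P : Profile n m) : Prop :=
  ∀ i : Fin n, RowAt mem (a + i * m) (P i)

theorem toNat_injective : Function.Injective Bool.toNat := by decide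

theorem exists_lt_succ_iff {k : ℕ} (hk : k < n) (p : Fin n → Prop) :
    (∃ i : Fin n, i.val < k + 1 ∧ p i) ↔ (∃ i : Fin n, i.val < k ∧ p i) ∨ p ⟨k, hk⟩ := by
  constructor
  · rintro ⟨i, hi, h⟩
    rcases Nat.lt_succ_iff_lt_or_eq.1 hi with hi | hi
    · exact .inl ⟨i, hi, h⟩
    · obtain rfl : i = ⟨k, hk⟩ := Fin.ext hi
      exact .inr h
  · rintro (⟨i, hi, h⟩ | h)
    · exact ⟨i, by omega, h⟩
    · exact ⟨_, by simp, h⟩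

theorem forall_lt_succ_iff {k : ℕ} (hk : k < n) (p : Fin n → Prop) :
    (∀ i : Fin n, i.val < k + 1 → p i) ↔ (∀ i : Fin n, i.val < k → p i) ∧ p ⟨k, hk⟩ := by
  have := exists_lt_succ_iff hk fun i => ¬ p i
  rw [← not_iff_not] at this
  simpa [not_or] using this

theorem runs_compareRows {J K : Judgment m} (hM : s.reg rM = m) (hZ : m ≤ Z)
    (hJ : RowAt s.mem (s.reg rRowA) J) (hK : RowAt s.mem (s.reg rRowB) K) :
    Runs ω Z compareRows s fun u => u.reg rDiff = 0 ↔ J = K := by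
  refine Runs.seq (Runs.assign ?_)
  refine Runs.upto (N := m) (fun k u => u.reg rDiff = 0 ↔ ∀ φ : Fin m, φ < k → J φ = K φ)
    (by simp [hM]) hZ (by decide) (by simp) (fun k hk u hu hx hI => ?_) (fun u _ hI => ?_)
  · have hA : u.reg rRowA = s.reg rRowA := hu.reg _ rfl
    have hB : u.reg rRowB = s.reg rRowB := hu.reg _ rfl
    have hm : u.mem = s.mem := hu.mem rfl
    have hiff : (Expr.absDiff (cell rRowA (.reg rIssue)) (cell rRowB (.reg rIssue))).eval u = 0 ↔
        J ⟨k, hk⟩ = K ⟨k, hk⟩ := by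
      rw [Expr.eval_absDiff_eq_zero]
      simp only [cell, Expr.eval_mem, Expr.eval_add, Expr.eval_reg, hA, hB, hm, hx]
      rw [hJ ⟨k, hk⟩, hK ⟨k, hk⟩, toNat_injective.eq_iff]
    refine Runs.ite (fun h => Runs.assign ?_) (fun h => Runs.skip ?_)
    · rw [ne_eq, hiff] at h
      simp only [Config.set_reg, forall_lt_succ_iff hk, h, and_false]
      simp
    · rw [hiff] at h
      simp only [Config.set_reg, forall_lt_succ_iff hk, h, and_true, ← hI]
      simp
  · rw [hI, funext_iff]
    exact forall_congr' fun φ => by simp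

theorem runs_checkSubset {P Q : Profile n m} (hN : s.reg rN = n) (hM : s.reg rM = m) (hnZ : n ≤ Z)
    (hmZ : m ≤ Z) (hP : ProfileAt s.mem (s.reg rProfA) P) (hQ : ProfileAt s.mem (s.reg rProfB) Q) :
    Runs ω Z checkSubset s fun u => u.reg rMiss = 0 ↔ s.reg rMiss = 0 ∧
      Set.range P ⊆ Set.range Q := by
  refine Runs.seq (Runs.assign ?_)
  refine Runs.upto (N := n) (fun k u => u.reg rRowA = s.reg rProfA + k * m ∧ (u.reg rMiss = 0 ↔
    s.reg rMiss = 0 ∧ ∀ i : Fin n, i < k → P i ∈ Set.range Q))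
    (by simp [hN]) hnZ (by decide) (by simp) (fun k hk u hu _ hI => ?_) (fun u _ hI => ?_)
  · have hA : u.reg rProfA = s.reg rProfA := hu.reg _ rfl
    have hB : u.reg rProfB = s.reg rProfB := hu.reg _ rfl
    have hN' : u.reg rN = s.reg rN := hu.reg _ rfl
    have hM' : u.reg rM = s.reg rM := hu.reg _ rfl
    have hm : u.mem = s.mem := hu.mem rfl
    refine Runs.seq (Runs.assign (Runs.seq (Runs.assign (Runs.seq ?_))))
    refine Runs.upto (N := n) (fun j v => v.reg rRowB = s.reg rProfB + j * m ∧ (v.reg rHit ≠ 0 ↔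
      ∃ i : Fin n, i < j ∧ Q i = P ⟨k, hk⟩))
      (by simp [hN', hN]) hnZ (by decide) (by simp [hB]) (fun j hj v hv _ hJ => ?_)
      (fun v hv hJ => ?_)
    · have hA' : v.reg rRowA = u.reg rRowA := hv.reg _ rfl
      have hM'' : v.reg rM = u.reg rM := hv.reg _ rfl
      have hm' : v.mem = u.mem := hv.mem rfl
      refine Runs.seq ((runs_compareRows (J := P ⟨k, hk⟩) (K := Q ⟨j, hj⟩)
        (by rw [hM'', hM', hM]) hmZ (by rw [hA', hm', hm, hI.1]; exact hP ⟨k, hk⟩)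
        (by rw [hJ.1, hm', hm]; exact hQ ⟨j, hj⟩)).mono fun w hw hd => Runs.seq ?_)
      have hB' : w.reg rRowB = v.reg rRowB := hw.reg _ rfl
      have hH : w.reg rHit = v.reg rHit := hw.reg _ rfl
      have hM3 : w.reg rM = v.reg rM := hw.reg _ rfl
      refine Runs.ite (fun h => Runs.skip (Runs.assign ?_)) (fun h => Runs.assign (Runs.assign ?_))
      · simp only [Expr.eval_reg, ne_eq, hd] at h
        simp only [Config.set_reg, Expr.eval_add, Expr.eval_reg, exists_lt_succ_iff hj, Ne.symm h,
          or_false, ← hJ.2]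
        simp [hB', hH, hJ.1, hM3, hM'', hM', hM, Nat.succ_mul, Nat.add_assoc]
      · simp only [Expr.eval_reg, hd] at h
        simp only [Config.set_reg, Expr.eval_add, Expr.eval_reg, exists_lt_succ_iff hj, h, or_true]
        simp [hB', hJ.1, hM3, hM'', hM', hM, Nat.succ_mul, Nat.add_assoc]
    · have hhit : v.reg rHit ≠ 0 ↔ P ⟨k, hk⟩ ∈ Set.range Q := by
        rw [hJ.2]
        simp
      have hA' : v.reg rRowA = u.reg rRowA := hv.reg _ rfl
      have hM'' : v.reg rM = u.reg rM := hv.reg _ rfl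
      have hMi : v.reg rMiss = u.reg rMiss := hv.reg _ rfl
      refine Runs.seq ?_
      refine Runs.ite (fun h => Runs.skip (Runs.assign ?_)) (fun h => Runs.assign (Runs.assign ?_))
      · rw [Expr.eval_reg, hhit] at h
        simp only [Config.set_reg, Expr.eval_add, Expr.eval_reg, forall_lt_succ_iff hk]
        simp only [h, and_true]
        simp [hA', hI, hMi, hM'', hM', hM, Nat.succ_mul, Nat.add_assoc]
      · rw [Expr.eval_reg, ← not_ne_iff, hhit] at h
        simp only [Config.set_reg, Expr.eval_add, Expr.eval_reg, forall_lt_succ_iff hk]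
        simp only [h, and_false]
        simp [hA', hI, hM'', hM', hM, Nat.succ_mul, Nat.add_assoc]
  · rw [hI.2, Set.range_subset_iff]
    exact and_congr_right fun _ => forall_congr' fun i => by simp

theorem runs_checkRepeats {P : Profile n m} {f : ℕ → Profile n m} {t : ℕ} (hN : s.reg rN = n)
    (hM : s.reg rM = m) (hNM : s.reg rNM = n * m) (ht : s.reg rT = t) (hnZ : n ≤ Z) (hmZ : m ≤ Z)
    (htZ : t ≤ Z) (hP : ProfileAt s.mem (s.reg rCur) P)
    (hf : ∀ k < t, ProfileAt s.mem (s.reg rBase + k * (n * m)) (f k)) :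
    Runs ω Z checkRepeats s fun u => u.reg rRepeats ≠ 0 ↔
      ∃ k < t, Set.range P = Set.range (f k) := by
  refine Runs.seq (Runs.assign (Runs.seq (Runs.assign ?_)))
  refine Runs.upto (N := t) (fun k u => u.reg rOld = s.reg rBase + k * (n * m) ∧
    (u.reg rRepeats ≠ 0 ↔ ∃ k' < k, Set.range P = Set.range (f k')))
    (by simp [ht]) htZ (by decide) (by simp) (fun k hk u hu _ hI => ?_) (fun u _ hI => hI.2)
  have hC : u.reg rCur = s.reg rCur := hu.reg _ rfl
  have hN' : u.reg rN = s.reg rN := hu.reg _ rfl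
  have hM' : u.reg rM = s.reg rM := hu.reg _ rfl
  have hNM' : u.reg rNM = s.reg rNM := hu.reg _ rfl
  have hm : u.mem = s.mem := hu.mem rfl
  refine Runs.seq (Runs.assign (Runs.seq (Runs.assign (Runs.seq (Runs.assign (Runs.seq ?_))))))
  refine (runs_checkSubset (P := P) (Q := f k) (by simp [hN', hN]) (by simp [hM', hM]) hnZ hmZ
    (by simpa [hm, hC] using hP) (by simpa [hm, hI.1] using hf k hk)).mono fun v hv hd => ?_
  have hC' : v.reg rCur = u.reg rCur := hv.reg _ rfl
  have hO : v.reg rOld = u.reg rOld := hv.reg _ rfl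
  have hN'' : v.reg rN = u.reg rN := hv.reg _ rfl
  have hM'' : v.reg rM = u.reg rM := hv.reg _ rfl
  have hm' : v.mem = u.mem := hv.mem rfl
  refine Runs.seq (Runs.assign (Runs.seq (Runs.assign (Runs.seq ?_))))
  refine (runs_checkSubset (P := f k) (Q := P) (by simp [hN'', hN', hN]) (by simp [hM'', hM', hM])
    hnZ hmZ (by simpa [hm', hm, hO, hI.1] using hf k hk)
    (by simpa [hm', hm, hC', hC] using hP)).mono fun w hw he => Runs.seq ?_
  have hO' : w.reg rOld = v.reg rOld := hw.reg _ rfl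
  have hR : w.reg rRepeats = u.reg rRepeats := (hw.reg _ rfl).trans (hv.reg _ rfl)
  have hNM'' : w.reg rNM = u.reg rNM := (hw.reg _ rfl).trans (hv.reg _ rfl)
  have hmiss : w.reg rMiss = 0 ↔ Set.range P = Set.range (f k) := by
    simp only [Config.set_reg] at hd he
    rw [he, Set.Subset.antisymm_iff]
    simp [hd]
  have hex : (∃ k' < k + 1, Set.range P = Set.range (f k')) ↔
      (∃ k' < k, Set.range P = Set.range (f k')) ∨ Set.range P = Set.range (f k) :=
    ⟨fun ⟨k', hk', h⟩ => (Nat.lt_succ_iff_lt_or_eq.1 hk').imp (fun hk' => ⟨k', hk', h⟩)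
      (by rintro rfl; exact h), fun h => h.elim (fun ⟨k', hk', h⟩ => ⟨k', by omega, h⟩)
      fun h => ⟨k, by omega, h⟩⟩
  refine Runs.ite (fun h => Runs.skip (Runs.assign ?_)) (fun h => Runs.assign (Runs.assign ?_))
  · rw [Expr.eval_reg, ne_eq, hmiss] at h
    rw [hex]
    simp only [Config.set_reg, Expr.eval_add, Expr.eval_reg, h, or_false, ← hI.2]
    simp [hO', hO, hI.1, hR, hNM'', hNM', hNM, Nat.succ_mul, Nat.add_assoc]
  · rw [Expr.eval_reg, hmiss] at h
    rw [hex]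
    simp only [Config.set_reg, Expr.eval_add, Expr.eval_reg, h, or_true]
    simp [hO', hO, hI.1, hNM'', hNM', hNM, Nat.succ_mul, Nat.add_assoc]

theorem runs_checkUnanimous {P : Profile n m} (hn : 0 < n) (hN : s.reg rN = n) (hM : s.reg rM = m)
    (hnZ : n ≤ Z) (hmZ : m ≤ Z) (hP : ProfileAt s.mem (s.reg rCur) P) :
    Runs ω Z checkUnanimous s fun u => u.reg rSplit = 0 ↔ ∀ i, P i = P ⟨0, hn⟩ := by
  refine Runs.seq (Runs.assign (Runs.seq (Runs.assign (Runs.seq (Runs.assign ?_)))))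
  refine Runs.upto (N := n) (fun k u => u.reg rRowB = s.reg rCur + k * m ∧ (u.reg rSplit = 0 ↔
    ∀ i : Fin n, i < k → P i = P ⟨0, hn⟩))
    (by simp [hN]) hnZ (by decide) (by simp) (fun k hk u hu _ hI => ?_) (fun u _ hI => ?_)
  · have hA : u.reg rRowA = s.reg rCur := by simpa using hu.reg rRowA rfl
    have hM' : u.reg rM = s.reg rM := hu.reg _ rfl
    have hm : u.mem = s.mem := hu.mem rfl
    refine Runs.seq ((runs_compareRows (J := P ⟨0, hn⟩) (K := P ⟨k, hk⟩) (by rw [hM', hM]) hmZ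
      (by rw [hA, hm]; simpa using hP ⟨0, hn⟩)
      (by rw [hI.1, hm]; exact hP ⟨k, hk⟩)).mono fun w hw hd => Runs.seq ?_)
    have hB : w.reg rRowB = u.reg rRowB := hw.reg _ rfl
    have hS : w.reg rSplit = u.reg rSplit := hw.reg _ rfl
    have hM'' : w.reg rM = u.reg rM := hw.reg _ rfl
    refine Runs.ite (fun h => Runs.assign (Runs.assign ?_)) (fun h => Runs.skip (Runs.assign ?_))
    · rw [Expr.eval_reg, ne_eq, hd] at h
      rw [forall_lt_succ_iff hk]
      simp only [Config.set_reg, Expr.eval_add, Expr.eval_reg, Ne.symm h, and_false]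
      simp [hB, hI.1, hM'', hM', hM, Nat.succ_mul, Nat.add_assoc]
    · rw [Expr.eval_reg, hd] at h
      rw [forall_lt_succ_iff hk]
      simp only [Config.set_reg, Expr.eval_add, Expr.eval_reg, ← h, and_true]
      simp [hB, hI, hS, hM'', hM', hM, Nat.succ_mul, Nat.add_assoc]
  · rw [hI.2]
    exact forall_congr' fun i => by simp

/-! ### Output -/

/-- The truth values of a judgment. -/
def rowCode (J : Judgment m) : List ℕ := (List.finRange m).map fun φ => (J φ).toNat

theorem runs_emitRow {J : Judgment m} (hM : s.reg rM = m) (hmZ : m ≤ Z)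
    (hJ : RowAt s.mem (s.reg rRowB) J) :
    Runs ω Z emitRow s fun u => u.out = s.out ++ rowCode J := by
  refine Runs.upto (N := m) (fun k u => u.out = s.out ++ ((List.finRange m).take k).map
    fun φ => (J φ).toNat) hM hmZ (by decide) (by simp) (fun k hk u hu hx hI => ?_)
    (fun u _ hI => ?_)
  · have hB : u.reg rRowB = s.reg rRowB := hu.reg _ rfl
    have hm : u.mem = s.mem := hu.mem rfl
    refine Runs.emit ?_
    rw [List.take_succ_eq_append_getElem (by simpa using hk)]
    simp [hI, cell, hB, hm, hx, hJ ⟨k, hk⟩]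
  · rw [hI, rowCode, List.take_of_length_le (by simp)]

theorem runs_emitProfile {P : Profile n m} (hN : s.reg rN = n) (hM : s.reg rM = m) (hnZ : n ≤ Z)
    (hmZ : m ≤ Z) (hP : ProfileAt s.mem (s.reg rCur) P) :
    Runs ω Z emitProfile s fun u => u.out = s.out ++ Profile.code P := by
  refine Runs.seq (Runs.assign ?_)
  refine Runs.upto (N := n) (fun k u => u.reg rRowB = s.reg rCur + k * m ∧
    u.out = s.out ++ ((List.finRange n).take k).flatMap fun i => rowCode (P i))
    (by simp [hN]) hnZ (by decide) (by simp) (fun k hk u hu _ hI => ?_) (fun u _ hI => ?_)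
  · have hM' : u.reg rM = s.reg rM := hu.reg _ rfl
    have hm : u.mem = s.mem := hu.mem rfl
    refine Runs.seq ((runs_emitRow (J := P ⟨k, hk⟩) (by rw [hM', hM]) hmZ
      (by rw [hm, hI.1]; exact hP ⟨k, hk⟩)).mono fun v hv ho => Runs.assign ?_)
    have hB : v.reg rRowB = u.reg rRowB := hv.reg _ rfl
    have hM'' : v.reg rM = u.reg rM := hv.reg _ rfl
    rw [List.take_succ_eq_append_getElem (by simpa using hk)]
    simp [hB, hI, hM'', hM', hM, ho, Nat.succ_mul, Nat.add_assoc]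
  · rw [hI.2, List.take_of_length_le (by simp)]
    rfl

theorem runs_finalChoice {P : Profile n m} (hn : 0 < n) (hN : s.reg rN = n) (hM : s.reg rM = m)
    (hnZ : n ≤ Z) (hmZ : m ≤ Z) (hP : ProfileAt s.mem (s.reg rCur) P) :
    Runs ω Z finalChoice s fun u => u.out = s.out ++ Profile.code (n := n)
      fun _ => P ⟨ω (s.reg rChoices) % n, Nat.mod_lt _ hn⟩ := by
  set j : Fin n := ⟨ω (s.reg rChoices) % n, Nat.mod_lt _ hn⟩ with hj
  have hans : answer ω (s.reg rChoices) n = j := by simp [answer, hn.ne', hj]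
  refine Runs.seq (Runs.pick (Runs.seq (Runs.assign (Runs.seq ?_))))
  refine Runs.upto (N := j) (fun k u => u.reg rRowB = s.reg rCur + k * m)
    (by simp [hN, hans]) (j.2.le.trans hnZ) (by decide) (by simp) (fun k hk u hu _ hI => ?_)
    (fun u hu hI => ?_)
  · have hM' : u.reg rM = s.reg rM := by simpa using hu.reg rM rfl
    refine Runs.assign ?_
    simp [hI, hM', hM, Nat.succ_mul, Nat.add_assoc]
  · have hN' : u.reg rN = s.reg rN := by simpa using hu.reg rN rfl
    have hM' : u.reg rM = s.reg rM := by simpa using hu.reg rM rfl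
    have hm : u.mem = s.mem := by simpa using hu.mem rfl
    have ho : u.out = s.out := by simpa using hu.out rfl
    refine Runs.upto (N := n) (fun k v =>
      v.out = s.out ++ ((List.finRange n).take k).flatMap fun _ => rowCode (P j))
      (by simp [hN', hN]) hnZ (by decide) (by simp [ho]) (fun k hk v hv _ hI' => ?_)
      (fun v _ hI' => ?_)
    · have hM'' : v.reg rM = u.reg rM := hv.reg _ rfl
      have hB : v.reg rRowB = u.reg rRowB := hv.reg _ rfl
      have hm' : v.mem = u.mem := hv.mem rfl
      refine (runs_emitRow (J := P j) (by rw [hM'', hM', hM]) hmZ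
        (by rw [hm', hm, hB, hI]; exact hP j)).mono fun w _ hw => ?_
      rw [List.take_succ_eq_append_getElem (by simpa using hk)]
      simp [hw, hI']
    · rw [hI', List.take_of_length_le (by simp)]
      rfl

/-! ### Evaluation of the formula -/

/-- The list `l` is stored from address `a` on. -/
def ListAt (mem : ℕ → ℕ) (a : ℕ) (l : List ℕ) : Prop :=
  ∀ k (h : k < l.length), mem (a + k) = l[k]

theorem listAt_append {mem : ℕ → ℕ} {a : ℕ} {l l' : List ℕ} :
    ListAt mem a (l ++ l') ↔ ListAt mem a l ∧ ListAt mem (a + l.length) l' := by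
  constructor
  · refine fun h => ⟨fun k hk => ?_, fun k hk => ?_⟩
    · rw [h k (by simp; omega), List.getElem_append_left hk]
    · rw [Nat.add_assoc, h (l.length + k) (by simpa using hk),
        List.getElem_append_right (Nat.le_add_right _ _)]
      simp
  · rintro ⟨h, h'⟩ k hk
    by_cases hkl : k < l.length
    · rw [List.getElem_append_left hkl, h k hkl]
    · rw [List.length_append] at hk
      rw [List.getElem_append_right (by omega), ← h' (k - l.length) (by omega)]
      congr 1
      omega

theorem ListAt.congr {mem mem' : ℕ → ℕ} {a : ℕ} {l : List ℕ} (h : ListAt mem a l)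
    (hm : ∀ x < a + l.length, mem' x = mem x) : ListAt mem' a l :=
  fun k hk => by rw [hm _ (by omega), h k hk]

theorem RowAt.congr {mem mem' : ℕ → ℕ} {a : ℕ} {J : Judgment m} (h : RowAt mem a J)
    (hm : ∀ x < a + m, mem' x = mem x) : RowAt mem' a J :=
  fun φ => by rw [hm _ (by have := φ.2; omega), h φ]

theorem ProfileAt.congr {mem mem' : ℕ → ℕ} {a : ℕ} {P : Profile n m} (h : ProfileAt mem a P)
    (hm : ∀ x < a + n * m, mem' x = mem x) : ProfileAt mem' a P := by
  refine fun i => (h i).congr fun x hx => hm x ?_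
  have := Nat.mul_le_mul_right m (Nat.succ_le_of_lt i.2)
  rw [Nat.succ_mul] at this
  omega

theorem runs_evalSymbol_var {J : Judgment m} {φ ψ : Fin m} (hs : s.mem (s.reg rPos) = ψ + 4)
    (hφ : s.reg rPhi = φ) (hJ : RowAt s.mem (s.reg rRow) J) :
    Runs ω Z evalSymbol s fun u => u.reg rPos = s.reg rPos + 1 ∧ u.reg rTop = s.reg rTop + 1 ∧
      u.mem (s.reg rTop) = (flip J φ ψ).toNat ∧ ∀ a < s.reg rTop, u.mem a = s.mem a := by
  refine Runs.seq (Runs.assign (Runs.seq (Runs.ite (fun _ => ?_) (fun h => ?_))))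
  · refine Runs.seq (Runs.store (Runs.assign (Runs.assign ?_)))
    refine ⟨by simp, by simp, ?_, fun a ha => by simp [ha.ne]⟩
    simp only [Config.set_mem, Config.put_mem, Expr.eval_reg, Config.set_reg]
    rw [if_pos (by simp), Expr.eval_absDiff_toNat (b := J ψ) (p := ψ = φ), flip_apply]
    · simpa [cell, hs] using hJ ψ
    · simp [hs, hφ, Fin.ext_iff]
  · simp [hs] at h

theorem runs_evalSymbol_neg {b : Bool} {t : ℕ} (hs : s.mem (s.reg rPos) = 0)
    (ht : s.reg rTop = t + 1) (hb : s.mem t = b.toNat) :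
    Runs ω Z evalSymbol s fun u => u.reg rPos = s.reg rPos + 1 ∧ u.reg rTop = t + 1 ∧
      u.mem t = (!b).toNat ∧ ∀ a < t, u.mem a = s.mem a := by
  refine Runs.seq (Runs.assign (Runs.seq (Runs.ite (fun h => ?_) (fun _ => ?_))))
  · simp [hs] at h
  · refine Runs.ite (fun h => ?_) (fun _ => ?_)
    · simp [hs] at h
    · refine Runs.store (Runs.assign ?_)
      refine ⟨by simp, by simp [ht], ?_, fun a ha => by simp [ht, ha.ne]⟩
      cases b <;> simp [ht, hb]

theorem runs_evalSymbol_binary {a b : Bool} {t c : ℕ} {f : Bool → Bool → Bool}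
    (hf : c = 1 ∧ f = (fun a b => a && b) ∨ c = 2 ∧ f = (fun a b => a || b) ∨
      c = 3 ∧ f = fun a b => !a || b)
    (hs : s.mem (s.reg rPos) = c) (ht : s.reg rTop = t + 2) (ha : s.mem t = a.toNat)
    (hb : s.mem (t + 1) = b.toNat) :
    Runs ω Z evalSymbol s fun u => u.reg rPos = s.reg rPos + 1 ∧ u.reg rTop = t + 1 ∧
      u.mem t = (f a b).toNat ∧ ∀ x < t, u.mem x = s.mem x := by
  refine Runs.seq (Runs.assign (Runs.seq (Runs.ite (fun h => ?_) (fun _ => ?_))))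
  · simp only [Expr.eval_sub, Expr.eval_reg, Config.set_reg, Expr.eval_mem, Expr.eval_const,
      if_true, hs] at h
    omega
  · refine Runs.ite (fun _ => ?_) (fun h => ?_)
    · refine Runs.seq (Runs.assign (Runs.ite (fun h => ?_) (fun h => ?_)))
      · refine Runs.ite (fun h' => ?_) (fun h' => ?_)
        · refine Runs.store (Runs.assign ?_)
          simp [hs] at h h'
          obtain ⟨-, rfl⟩ : c = 3 ∧ f = fun a b => !a || b := by
            rcases hf with hf | hf | hf <;> first | exact hf | omega
          refine ⟨by simp, by simp [ht], ?_, fun x hx => by simp [ht, hx.ne]⟩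
          cases a <;> cases b <;> simp [ht, ha, hb]
        · refine Runs.store (Runs.assign ?_)
          simp [hs] at h h'
          obtain ⟨-, rfl⟩ : c = 2 ∧ f = fun a b => a || b := by
            rcases hf with hf | hf | hf <;> first | exact hf | omega
          refine ⟨by simp, by simp [ht], ?_, fun x hx => by simp [ht, hx.ne]⟩
          cases a <;> cases b <;> simp [ht, ha, hb]
      · refine Runs.store (Runs.assign ?_)
        simp [hs] at h
        obtain ⟨-, rfl⟩ : c = 1 ∧ f = fun a b => a && b := by
          rcases hf with hf | hf | hf <;> first | exact hf | omega
        refine ⟨by simp, by simp [ht], ?_, fun x hx => by simp [ht, hx.ne]⟩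
        cases a <;> cases b <;> simp [ht, ha, hb]
    · simp [hs] at h
      omega

theorem Iter.of_runs {e : Expr} {p : Prog} {Q : Config → Prop} (he : e.eval s ≠ 0)
    (h : Runs ω Z p s Q) : ∃ u, Iter ω Z e p 1 s u ∧ Q u := by
  obtain ⟨u, c, hu, hc, hQ⟩ := h
  exact ⟨u, ⟨he, u, c, hu, hc, rfl⟩, hQ⟩

/-- Processing the symbols `l` pushes the truth value `b` on the stack, when the judgment at `rRow`
is `J` and the issue to be flipped is `φ`. -/
def Pushes (ω : ℕ → ℕ) (Z : ℕ) (J : Judgment m) (φ : Fin m) (l : List ℕ) (b : Bool) : Prop :=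
  ∀ s : Config, ListAt s.mem (s.reg rPos) l → s.reg rPos + l.length ≤ s.reg rBase →
    s.reg rBase ≤ s.reg rTop → RowAt s.mem (s.reg rRow) J → s.reg rRow + m ≤ s.reg rTop →
    s.reg rPhi = φ → ∃ u, Iter ω Z (.sub (.reg rBase) (.reg rPos)) evalSymbol l.length s u ∧
      u.reg rPos = s.reg rPos + l.length ∧ u.reg rTop = s.reg rTop + 1 ∧
      u.mem (s.reg rTop) = b.toNat ∧ ∀ a < s.reg rTop, u.mem a = s.mem a

theorem Pushes.neg {J : Judgment m} {φ : Fin m} {l : List ℕ} {b : Bool}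
    (h : Pushes ω Z J φ l b) : Pushes ω Z J φ (l ++ [0]) (!b) := by
  intro s hl hle hbt hJ hr hφ
  obtain ⟨hl1, hl2⟩ := listAt_append.1 hl
  simp only [List.length_append, List.length_cons, List.length_nil] at hle ⊢
  obtain ⟨u, hu, hpu, htu, hbu, hmu⟩ := h s hl1 (by omega) hbt hJ hr hφ
  have hB : u.reg rBase = s.reg rBase := hu.frame.reg _ rfl
  have hsym := hl2 0 (by simp)
  simp only [Nat.add_zero, List.getElem_cons_zero] at hsym
  obtain ⟨v, hv, hpv, htv, hbv, hmv⟩ := Iter.of_runs (e := .sub (.reg rBase) (.reg rPos))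
    (by simp [hB, hpu]; omega) (runs_evalSymbol_neg (ω := ω) (Z := Z) (s := u) (b := b)
      (by rw [hpu, hmu _ (by omega), hsym]) htu hbu)
  exact ⟨v, hu.trans hv, by rw [hpv, hpu, Nat.add_assoc], htv, hbv,
    fun a ha => by rw [hmv a ha, hmu a ha]⟩

theorem Pushes.binary {J : Judgment m} {φ : Fin m} {l l' : List ℕ} {b b' : Bool} {c : ℕ}
    {f : Bool → Bool → Bool} (hf : c = 1 ∧ f = (fun a b => a && b) ∨
      c = 2 ∧ f = (fun a b => a || b) ∨ c = 3 ∧ f = fun a b => !a || b)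
    (h : Pushes ω Z J φ l b) (h' : Pushes ω Z J φ l' b') :
    Pushes ω Z J φ (l ++ l' ++ [c]) (f b b') := by
  intro s hl hle hbt hJ hr hφ
  obtain ⟨hl, hl3⟩ := listAt_append.1 hl
  obtain ⟨hl1, hl2⟩ := listAt_append.1 hl
  simp only [List.length_append, List.length_cons, List.length_nil] at hle hl3 ⊢
  obtain ⟨u, hu, hpu, htu, hbu, hmu⟩ := h s hl1 (by omega) hbt hJ hr hφ
  have hB : u.reg rBase = s.reg rBase := hu.frame.reg _ rfl
  have hR : u.reg rRow = s.reg rRow := hu.frame.reg _ rfl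
  have hF : u.reg rPhi = s.reg rPhi := hu.frame.reg _ rfl
  obtain ⟨v, hv, hpv, htv, hbv, hmv⟩ := h' u
    (by rw [hpu]; exact hl2.congr fun x hx => hmu x (by omega)) (by omega) (by omega)
    (by rw [hR]; exact hJ.congr fun x hx => hmu x (by omega)) (by omega) (by rw [hF, hφ])
  have hB' : v.reg rBase = u.reg rBase := hv.frame.reg _ rfl
  have hsym := hl3 0 (by simp)
  simp only [Nat.add_zero, List.getElem_cons_zero] at hsym
  obtain ⟨w, hw, hpw, htw, hbw, hmw⟩ := Iter.of_runs (e := .sub (.reg rBase) (.reg rPos))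
    (by simp [hB', hB, hpv, hpu]; omega)
    (runs_evalSymbol_binary (ω := ω) (Z := Z) (s := v) (a := b) (b := b') (t := s.reg rTop) hf
      (by rw [hpv, hpu, hmv _ (by omega), hmu _ (by omega), Nat.add_assoc, hsym])
      (by rw [htv, htu]) (by rw [hmv _ (by omega), hbu]) (by rw [← htu, hbv]))
  exact ⟨w, (hu.trans hv).trans hw, by rw [hpw, hpv, hpu]; omega, htw, hbw,
    fun a ha => by rw [hmw a ha, hmv a (by omega), hmu a ha]⟩

/-- The postfix notation of a formula, read from left to right, pushes its truth value. -/
theorem pushes_code (J : Judgment m) (φ : Fin m) (A : Formula m) :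
    Pushes ω Z J φ A.code (A.eval (flip J φ)) := by
  induction A with
  | var ψ =>
    intro s hl hle hbt hJ hr hφ
    have hsym := hl 0 (by simp [Formula.code])
    simp only [Nat.add_zero, Formula.code, List.getElem_cons_zero] at hsym
    simp only [Formula.code, List.length_cons, List.length_nil] at hle ⊢
    exact Iter.of_runs (by simp; omega) (runs_evalSymbol_var hsym hφ hJ)
  | neg A ih => exact ih.neg
  | and A B ihA ihB => exact Pushes.binary (f := fun a b => a && b) (by simp) ihA ihB
  | or A B ihA ihB => exact Pushes.binary (f := fun a b => a || b) (by simp) ihA ihB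
  | imp A B ihA ihB => exact Pushes.binary (f := fun a b => !a || b) (by simp) ihA ihB

/-! ### One iteration -/

/-- The parameters are in their registers, and the formula is in memory. -/
structure Setting (n : ℕ) {m : ℕ} (Γ : Formula m) (s : Config) : Prop where
  regN : s.reg rN = n
  regM : s.reg rM = m
  regNM : s.reg rNM = n * m
  regBase : s.reg rBase = 3 + Γ.code.length
  code : ListAt s.mem 3 Γ.code

variable {Γ : Formula m}

theorem Setting.congr {u : Config} (h : Setting n Γ s) (hN : u.reg rN = s.reg rN)
    (hM : u.reg rM = s.reg rM) (hNM : u.reg rNM = s.reg rNM) (hB : u.reg rBase = s.reg rBase)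
    (hm : ∀ a < 3 + Γ.code.length, u.mem a = s.mem a) : Setting n Γ u :=
  ⟨hN.trans h.regN, hM.trans h.regM, hNM.trans h.regNM, hB.trans h.regBase, h.code.congr hm⟩

theorem Setting.frame {u : Config} {p : Prog} (h : Setting n Γ s) (hf : Frame p s u)
    (hp : (p.writes rN || p.writes rM || p.writes rNM || p.writes rBase) = false)
    (hm : ∀ a < 3 + Γ.code.length, u.mem a = s.mem a) : Setting n Γ u := by
  simp only [Bool.or_eq_false_iff] at hp
  obtain ⟨⟨⟨h0, h1⟩, h2⟩, h3⟩ := hp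
  exact h.congr (hf.reg _ h0) (hf.reg _ h1) (hf.reg _ h2) (hf.reg _ h3) hm

theorem Setting.set {x v : ℕ} (h : Setting n Γ s) (hx : 3 < x) : Setting n Γ (s.set x v) := by
  refine h.congr ?_ ?_ ?_ ?_ fun _ _ => rfl <;> rw [Config.set_reg, if_neg (by omega)]

theorem runs_evalFormula {J : Judgment m} {φ : Fin m} (hs : Setting n Γ s) (hφ : s.reg rPhi = φ)
    (hL : Γ.code.length ≤ Z) (hJ : RowAt s.mem (s.reg rRow) J)
    (hbase : s.reg rBase ≤ s.reg rStack) (hrow : s.reg rRow + m ≤ s.reg rStack) :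
    Runs ω Z evalFormula s fun u => u.mem (s.reg rStack) = (Γ.eval (flip J φ)).toNat ∧
      ∀ a < s.reg rStack, u.mem a = s.mem a := by
  refine Runs.seq (Runs.assign (Runs.seq (Runs.assign ?_)))
  obtain ⟨u, hu, hp, ht, hb, hm⟩ := pushes_code (ω := ω) (Z := Z) J φ Γ
    ((s.set rPos 3).set rTop (s.reg rStack)) (by simpa using hs.code) (by simp [hs.regBase])
    (by simpa using hbase) (by simpa using hJ) (by simpa using hrow) (by simpa using hφ)
  have hB : u.reg rBase = s.reg rBase := by simpa using hu.frame.reg rBase rfl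
  simp only [Config.set_reg, Config.set_mem] at hb hm hp
  refine Iter.runs_loop (s' := u) hu hL ?_ ⟨by simpa using hb, by simpa using hm⟩
  simp [hB, hs.regBase, hp]

theorem runs_countSame {P : Profile n m} {i : Fin n} {φ : Fin m} (hN : s.reg rN = n)
    (hM : s.reg rM = m) (hnZ : n ≤ Z) (hφ : s.reg rPhi = φ)
    (hP : ProfileAt s.mem (s.reg rCur) P) (hrow : RowAt s.mem (s.reg rRow) (P i)) :
    Runs ω Z countSame s fun u => u.reg rKey = same P i φ := by
  refine Runs.seq (Runs.assign (Runs.seq (Runs.assign ?_)))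
  refine Runs.upto (N := n) (fun k u => u.reg rPtr = s.reg rCur + k * m + φ ∧
    u.reg rKey = ∑ j ∈ Finset.range k,
      if s.mem (s.reg rCur + j * m + φ) = s.mem (s.reg rRow + φ) then 1 else 0)
    (by simp [hN]) hnZ (by decide) (by simp [hφ]) (fun k hk u hu _ hI => ?_) (fun u _ hI => ?_)
  · have hM' : u.reg rM = s.reg rM := by simpa using hu.reg rM rfl
    have hF : u.reg rPhi = s.reg rPhi := by simpa using hu.reg rPhi rfl
    have hR : u.reg rRow = s.reg rRow := by simpa using hu.reg rRow rfl
    have hm : u.mem = s.mem := by simpa using hu.mem rfl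
    refine Runs.seq (Runs.assign (Runs.assign ?_))
    rw [Finset.sum_range_succ]
    simp [hI, hM', hM, cell, hF, hR, hm, hφ, Nat.succ_mul]
    omega
  · rw [hI.2, same, Finset.card_filter, Finset.sum_range]
    refine Finset.sum_congr rfl fun j _ => ?_
    rw [hP j φ, hrow φ]
    simp only [toNat_injective.eq_iff]

/-- Considering an issue amounts to one step of the scan for the best one. -/
theorem runs_considerIssue {P : Profile n m} {i : Fin n} {φ : Fin m} {fav : ℕ}
    (hs : Setting n Γ s) (hnZ : n ≤ Z) (hL : Γ.code.length ≤ Z) (hφ : s.reg rPhi = φ)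
    (hfav : s.reg rFav = fav) (hP : ProfileAt s.mem (s.reg rCur) P)
    (hrow : RowAt s.mem (s.reg rRow) (P i)) (hbase : s.reg rBase ≤ s.reg rStack)
    (hr : s.reg rRow + m ≤ s.reg rStack)
    (hb : (s.reg rBest, s.reg rBestKey) = bestIssue Γ P i fav φ) :
    Runs ω Z considerIssue s fun u =>
      (u.reg rBest, u.reg rBestKey) = bestIssue Γ P i fav (φ + 1) ∧
      ∀ a < s.reg rStack, u.mem a = s.mem a := by
  have hcand : cand Γ P i φ ↔ 2 * same P i φ ≤ n ∧ Γ.eval (flip (P i) φ) = true := by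
    simp [cand, Candidate]
  have hkey : sameNat P i φ = same P i φ := by simp [sameNat]
  rw [show bestIssue Γ P i fav (φ + 1) = if cand Γ P i φ ∧ sameNat P i φ <
    (bestIssue Γ P i fav φ).2 + (if φ.val = fav then 1 else 0) then (φ.val, sameNat P i φ)
    else bestIssue Γ P i fav φ from rfl, ← hb]
  simp only [hcand, hkey]
  refine Runs.seq ((runs_countSame hs.regN hs.regM hnZ hφ hP hrow).mono fun u hu hk => ?_)
  have hN : u.reg rN = n := (hu.reg _ rfl).trans hs.regN
  have hS : u.reg rStack = s.reg rStack := hu.reg _ rfl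
  have hR : u.reg rRow = s.reg rRow := hu.reg _ rfl
  have hB : u.reg rBase = s.reg rBase := hu.reg _ rfl
  have hF : u.reg rPhi = s.reg rPhi := hu.reg _ rfl
  have hFa : u.reg rFav = s.reg rFav := hu.reg _ rfl
  have hBe : u.reg rBest = s.reg rBest := hu.reg _ rfl
  have hBk : u.reg rBestKey = s.reg rBestKey := hu.reg _ rfl
  have hm : u.mem = s.mem := hu.mem rfl
  refine Runs.ite (fun h => ?_) (fun h => Runs.skip ?_)
  · have hle : 2 * same P i φ ≤ n := by
      simp only [Expr.eval_sub, Expr.eval_add, Expr.eval_reg, Expr.eval_const, hN, hk] at h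
      omega
    have hs' : Setting n Γ u := hs.frame hu rfl (by simp [hm])
    refine Runs.seq ((runs_evalFormula (J := P i) hs' (hF.trans hφ) hL (by rwa [hm, hR])
      (by rwa [hB, hS]) (by rwa [hR, hS])).mono fun v hv ⟨hval, hmv⟩ => ?_)
    have hS' : v.reg rStack = u.reg rStack := hv.reg _ rfl
    have hF' : v.reg rPhi = u.reg rPhi := hv.reg _ rfl
    have hFa' : v.reg rFav = u.reg rFav := hv.reg _ rfl
    have hBe' : v.reg rBest = u.reg rBest := hv.reg _ rfl
    have hBk' : v.reg rBestKey = u.reg rBestKey := hv.reg _ rfl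
    have hK : v.reg rKey = u.reg rKey := hv.reg _ rfl
    have hmem : ∀ a < s.reg rStack, v.mem a = s.mem a := fun a ha => by
      rw [hmv a (by rwa [hS]), hm]
    refine Runs.ite (fun h1 => ?_) (fun h1 => Runs.skip ?_)
    · have htrue : Γ.eval (flip (P i) φ) = true := by
        simp only [Expr.eval_mem, Expr.eval_reg, hS', hval] at h1
        revert h1; cases Γ.eval (flip (P i) φ) <;> simp
      refine Runs.ite (fun h2 => Runs.seq (Runs.assign (Runs.assign ?_))) (fun h2 => Runs.skip ?_)
      · have hlt : same P i φ < s.reg rBestKey + if φ.val = fav then 1 else 0 := by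
          simp only [Expr.eval_sub, Expr.eval_add, Expr.eval_reg, Expr.eval_isEq, hBk', hBk, hF',
            hF, hFa', hFa, hK, hk, hφ, hfav] at h2
          omega
        rw [if_pos ⟨⟨hle, htrue⟩, hlt⟩]
        exact ⟨by simp [hF', hF, hφ, hK, hk], hmem⟩
      · rw [if_neg]
        · exact ⟨by rw [hBe', hBk', hBe, hBk], hmem⟩
        · rintro ⟨-, hlt⟩
          simp only [Expr.eval_sub, Expr.eval_add, Expr.eval_reg, Expr.eval_isEq, hBk', hBk, hF',
            hF, hFa', hFa, hK, hk, hφ, hfav] at h2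
          omega
    · rw [if_neg]
      · exact ⟨by rw [hBe', hBk', hBe, hBk], hmem⟩
      · rintro ⟨⟨-, htrue⟩, -⟩
        simp [hS', hval, htrue] at h1
  · rw [if_neg]
    · exact ⟨by rw [hBe, hBk], by simp [hm]⟩
    · rintro ⟨⟨hle, -⟩, -⟩
      simp only [Expr.eval_sub, Expr.eval_add, Expr.eval_reg, Expr.eval_const, hN, hk] at h
      omega

/-- The judgment of one agent in the next profile is computed and stored. Nothing is assumed about
the memory above: it may hold remains of earlier evaluations of the formula. -/
theorem runs_moveAgent {P : Profile n m} {i : Fin n} {fav : Fin n → ℕ} (hs : Setting n Γ s)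
    (hnZ : n ≤ Z) (hmZ : m ≤ Z) (hL : Γ.code.length ≤ Z)
    (hfav : answer ω (s.reg rChoices) m = fav i) (hP : ProfileAt s.mem (s.reg rCur) P)
    (hrow : s.reg rRow = s.reg rCur + i * m) (hbase : s.reg rBase ≤ s.reg rNewRow)
    (hnew : s.reg rCur + n * m ≤ s.reg rNewRow) (hr : s.reg rRow + m ≤ s.reg rNewRow)
    (hst : s.reg rNewRow + m ≤ s.reg rStack) :
    Runs ω Z moveAgent s fun u => u.reg rChoices = s.reg rChoices + 1 ∧
      u.reg rRow = s.reg rRow + m ∧ u.reg rNewRow = s.reg rNewRow + m ∧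
      RowAt u.mem (s.reg rNewRow) (nextProfile Γ P fav i) ∧
      ∀ a < s.reg rNewRow, u.mem a = s.mem a := by
  refine Runs.seq (Runs.pick (Runs.seq (Runs.assign (Runs.seq (Runs.assign (Runs.seq
    (Runs.assign (Runs.seq ?_))))))))
  refine Runs.upto (N := m) (fun k u => (u.reg rBest, u.reg rBestKey) = bestIssue Γ P i (fav i) k ∧
    ∀ a < s.reg rStack, u.mem a = s.mem a) (by simp [hs.regM]) hmZ (by decide)
    ⟨by simp [hs.regN, hs.regM, bestIssue, scan], by simp⟩ (fun k hk u hu hx hI => ?_)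
    (fun u hu hI => ?_)
  · have hS : u.reg rStack = s.reg rStack := by simpa using hu.reg rStack rfl
    have hR : u.reg rRow = s.reg rRow := by simpa using hu.reg rRow rfl
    have hC : u.reg rCur = s.reg rCur := by simpa using hu.reg rCur rfl
    have hB : u.reg rBase = s.reg rBase := by simpa using hu.reg rBase rfl
    have hF : u.reg rFav = fav i := by
      rw [← hfav, hu.reg rFav rfl]
      simp [hs.regM]
    have hs' : Setting n Γ u := by
      refine Setting.frame ((((hs.set ?_).set ?_).set ?_).set ?_) hu rfl fun a ha => ?_
      iterate 4 omega
      exact hI.2 a (by have := hs.regBase; omega)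
    have hP' : ProfileAt u.mem (s.reg rCur) P := hP.congr fun x hx => hI.2 x (by omega)
    refine (runs_considerIssue (P := P) (i := i) (φ := ⟨k, hk⟩) hs' hnZ hL hx hF
      (by rwa [hC]) (by rw [hR, hrow]; exact hP' i) (by omega) (by omega) hI.1).mono
      fun v hv ⟨hb, hmv⟩ => ⟨by simpa using hb, fun a ha => ?_⟩
    rw [Config.set_mem, hmv a (by omega), hI.2 a ha]
  · have hM : u.reg rM = m := (hu.reg rM rfl).trans (by simpa using hs.regM)
    have hR : u.reg rRow = s.reg rRow := by simpa using hu.reg rRow rfl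
    have hNR : u.reg rNewRow = s.reg rNewRow := by simpa using hu.reg rNewRow rfl
    have hCh : u.reg rChoices = s.reg rChoices + 1 := by simpa using hu.reg rChoices rfl
    have hbest : u.reg rBest = (bestIssue Γ P i (fav i) m).1 := by rw [← hI.1]
    refine Runs.seq ?_
    refine Runs.upto (N := m) (fun k v => (∀ ψ : Fin m, ψ < k →
      v.mem (s.reg rNewRow + ψ) = (nextProfile Γ P fav i ψ).toNat) ∧
      ∀ a < s.reg rNewRow, v.mem a = s.mem a) hM hmZ (by decide)
      ⟨by simp, fun a ha => hI.2 a (by omega)⟩ (fun k hk v hv hx hJ => ?_) (fun v hv hJ => ?_)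
    · have hR' : v.reg rRow = u.reg rRow := hv.reg _ rfl
      have hNR' : v.reg rNewRow = u.reg rNewRow := hv.reg _ rfl
      have hbest' : v.reg rBest = u.reg rBest := hv.reg _ rfl
      refine Runs.store ⟨fun ψ hψ => ?_, fun a ha => ?_⟩
      · simp only [Config.set_mem, Config.put_mem, Expr.eval_add, Expr.eval_reg, hNR', hNR, hx]
        rcases Nat.lt_succ_iff_lt_or_eq.1 hψ with hψ | rfl
        · rw [if_neg (by omega), hJ.1 ψ hψ]
        · rw [if_pos rfl, Expr.eval_absDiff_toNat (b := P i ψ)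
            (p := ψ.val = (bestIssue Γ P i (fav i) m).1)]
          · rfl
          · simp only [cell, Expr.eval_mem, Expr.eval_add, Expr.eval_reg, hR', hR, hx]
            rw [hJ.2 _ (by omega), hrow, hP i ψ]
          · simp [hx, hbest', hbest]
      · simp only [Config.set_mem, Config.put_mem, Expr.eval_add, Expr.eval_reg, hNR', hNR, hx]
        rw [if_neg (by omega), hJ.2 a ha]
    · have hM' : v.reg rM = u.reg rM := hv.reg _ rfl
      have hR' : v.reg rRow = u.reg rRow := hv.reg _ rfl
      have hNR' : v.reg rNewRow = u.reg rNewRow := hv.reg _ rfl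
      have hCh' : v.reg rChoices = u.reg rChoices := hv.reg _ rfl
      refine Runs.seq (Runs.assign (Runs.assign ?_))
      simp only [Config.set_reg, Config.set_mem, Expr.eval_add, Expr.eval_reg]
      exact ⟨by simp [hCh', hCh], by simp [hR', hR, hM', hM], by simp [hNR', hNR, hM', hM],
        fun ψ => hJ.1 ψ ψ.2, hJ.2⟩

theorem mul_add_le_mul {k n : ℕ} (hk : k < n) (m : ℕ) : k * m + m ≤ n * m := by
  rw [← Nat.succ_mul]
  exact Nat.mul_le_mul_right m hk

theorem runs_iteration {P : Profile n m} (hs : Setting n Γ s) (hnZ : n ≤ Z) (hmZ : m ≤ Z)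
    (hL : Γ.code.length ≤ Z) (hP : ProfileAt s.mem (s.reg rCur) P)
    (hbase : s.reg rBase ≤ s.reg rCur) :
    Runs ω Z iteration s fun u => u.reg rChoices = s.reg rChoices + n ∧
      u.reg rCur = s.reg rCur + n * m ∧ u.reg rT = s.reg rT + 1 ∧
      ProfileAt u.mem (s.reg rCur + n * m)
        (nextProfile Γ P fun i => answer ω (s.reg rChoices + i) m) ∧
      ∀ a < s.reg rCur + n * m, u.mem a = s.mem a := by
  refine Runs.seq (Runs.assign (Runs.seq (Runs.assign (Runs.seq (Runs.assign (Runs.seq ?_))))))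
  refine Runs.upto (N := n) (fun k u => u.reg rChoices = s.reg rChoices + k ∧
    u.reg rRow = s.reg rCur + k * m ∧ u.reg rNewRow = s.reg rCur + n * m + k * m ∧
    (∀ i : Fin n, i < k → RowAt u.mem (s.reg rCur + n * m + i * m)
      (nextProfile Γ P (fun i => answer ω (s.reg rChoices + i) m) i)) ∧
    ∀ a < s.reg rCur + n * m, u.mem a = s.mem a) (by simp [hs.regN]) hnZ (by decide)
    (by simp [hs.regNM]) (fun k hk u hu _ hI => ?_) (fun u hu hI => ?_)
  · obtain ⟨hCh, hR, hNR, hrows, hm⟩ := hI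
    have hC : u.reg rCur = s.reg rCur := by simpa using hu.reg rCur rfl
    have hB : u.reg rBase = s.reg rBase := by simpa using hu.reg rBase rfl
    have hS : u.reg rStack = s.reg rCur + n * m + n * m := by
      rw [hu.reg rStack rfl]; simp [hs.regNM]
    have hs' : Setting n Γ u := by
      refine Setting.frame (((hs.set ?_).set ?_).set ?_) hu rfl fun a ha => ?_
      iterate 3 omega
      exact hm a (by have := hs.regBase; omega)
    have hkm := mul_add_le_mul hk m
    refine (runs_moveAgent (P := P) (i := ⟨k, hk⟩)
      (fav := fun i => answer ω (s.reg rChoices + i) m) hs' hnZ hmZ hL (by rw [hCh])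
      (by rw [hC]; exact hP.congr hm) (by rw [hR, hC]) (by omega) (by omega) (by omega)
      (by omega)).mono fun v hv ⟨hCh', hR', hNR', hrow, hm'⟩ => ?_
    simp only [Config.set_reg, Config.set_mem]
    refine ⟨by simp [hCh', hCh, Nat.add_assoc], by simp [hR', hR, Nat.succ_mul, Nat.add_assoc],
      by simp [hNR', hNR, Nat.succ_mul, Nat.add_assoc], fun i hi => ?_, fun a ha => ?_⟩
    · rcases Nat.lt_succ_iff_lt_or_eq.1 hi with hi | rfl
      · refine (hrows i hi).congr fun x hx => hm' x ?_
        have := mul_add_le_mul hi m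
        omega
      · rw [hNR] at hrow
        exact hrow
    · rw [hm' a (by omega), hm a ha]
  · obtain ⟨hCh, hR, hNR, hrows, hm⟩ := hI
    have hC : u.reg rCur = s.reg rCur := by simpa using hu.reg rCur rfl
    have hT : u.reg rT = s.reg rT := by simpa using hu.reg rT rfl
    have hNM : u.reg rNM = s.reg rNM := by simpa using hu.reg rNM rfl
    refine Runs.seq (Runs.assign (Runs.assign ?_))
    simp only [Config.set_reg, Config.set_mem]
    exact ⟨by simp [hCh], by simp [hC, hNM, hs.regNM], by simp [hT], fun i => hrows i i.2, hm⟩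

/-! ### The main loop -/

/-- The configuration of the program when it has carried out `t` iterations and not yet written the
current profile to the output. -/
structure AtTime (Γ : Formula m) (P₀ : Profile n m) (ω : ℕ → ℕ) (t : ℕ) (s : Config) : Prop where
  setting : Setting n Γ s
  regT : s.reg rT = t
  regCur : s.reg rCur = 3 + Γ.code.length + t * (n * m)
  regChoices : s.reg rChoices = t * n
  regGo : s.reg rGo = 1
  profiles : ∀ k ≤ t, ProfileAt s.mem (3 + Γ.code.length + k * (n * m)) (trace Γ P₀ ω k)
  out : s.out = execCode (past Γ P₀ ω t)

variable {P₀ : Profile n m}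

theorem execCode_cons (P : Profile n m) (h : List (Profile n m)) :
    execCode (P :: h) = execCode h ++ Profile.code P := by
  simp [execCode]

theorem trace_rational (h0 : ∀ i, P₀ i ∈ rational Γ) (t : ℕ) (i : Fin n) :
    trace Γ P₀ ω t i ∈ rational Γ := by
  induction t with
  | zero => exact h0 i
  | succ t ih =>
    rcases step_nextProfile Γ (trace Γ P₀ ω t) (fun i => answer ω (t * n + i) m) i with
      ⟨-, h⟩ | ⟨-, h⟩
    · exact h.1.1.2
    · rw [trace, h]; exact ih

theorem unanimous_iff {R : Set (Judgment m)} {P : Profile n m} (hn : 0 < n) (hP : ∀ i, P i ∈ R) :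
    Unanimous R P ↔ ∀ i, P i = P ⟨0, hn⟩ := by
  constructor
  · rintro ⟨J, -, hJ⟩ i
    have h : ∀ i, P i = J := fun i => by
      have : P i ∈ Set.range P := ⟨i, rfl⟩
      simpa [hJ] using this
    rw [h, h]
  · intro h
    refine ⟨P ⟨0, hn⟩, hP _, Set.eq_singleton_iff_unique_mem.2 ⟨⟨_, rfl⟩, ?_⟩⟩
    rintro _ ⟨i, rfl⟩
    exact h i

theorem runs_mainBody {t : ℕ} (hn : 0 < n) (h0 : ∀ i, P₀ i ∈ rational Γ) (hnZ : n ≤ Z)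
    (hmZ : m ≤ Z) (hL : Γ.code.length ≤ Z) (htZ : t ≤ Z) (hs : AtTime Γ P₀ ω t s) :
    Runs ω Z mainBody s fun u =>
      (Stops Γ P₀ ω t → u.reg rGo = 0 ∧ u.out = execCode (guidedExec Γ P₀ ω t hn)) ∧
      (¬ Stops Γ P₀ ω t → AtTime Γ P₀ ω (t + 1) u) := by
  have hset := hs.setting
  have hP : ProfileAt s.mem (s.reg rCur) (trace Γ P₀ ω t) := by
    rw [hs.regCur]; exact hs.profiles t le_rfl
  refine Runs.seq ((runs_emitProfile hset.regN hset.regM hnZ hmZ hP).mono fun u hu ho =>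
    Runs.seq ?_)
  have hm : u.mem = s.mem := hu.mem rfl
  have hset' : Setting n Γ u := hset.frame hu rfl (by simp [hm])
  have hC : u.reg rCur = s.reg rCur := hu.reg _ rfl
  rw [← hm, ← hC] at hP
  rw [hs.out, ← execCode_cons] at ho
  refine (runs_checkUnanimous hn hset'.regN hset'.regM hnZ hmZ hP).mono fun v hv hun => ?_
  have hm' : v.mem = u.mem := hv.mem rfl
  have ho' : v.out = u.out := hv.out rfl
  have hset'' : Setting n Γ v := hset'.frame hv rfl (by simp [hm'])
  have hC' : v.reg rCur = u.reg rCur := hv.reg _ rfl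
  have hT' : v.reg rT = t := ((hv.reg _ rfl).trans (hu.reg _ rfl)).trans hs.regT
  rw [← hm', ← hC'] at hP
  rw [← unanimous_iff hn (trace_rational h0 t)] at hun
  refine Runs.ite (fun h => Runs.seq ?_) (fun h => Runs.assign ⟨fun _ => ?_, fun hns => ?_⟩)
  · rw [Expr.eval_reg, ne_eq, hun] at h
    refine (runs_checkRepeats (f := trace Γ P₀ ω) hset''.regN hset''.regM hset''.regNM hT' hnZ hmZ
      htZ hP fun k hk => ?_).mono fun w hw hrep => ?_
    · rw [hset''.regBase, hm', hm]
      exact hs.profiles k hk.le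
    have hm'' : w.mem = v.mem := hw.mem rfl
    have ho'' : w.out = v.out := hw.out rfl
    have hset3 : Setting n Γ w := hset''.frame hw rfl (by simp [hm''])
    have hC'' : w.reg rCur = v.reg rCur := hw.reg _ rfl
    have hT'' : w.reg rT = v.reg rT := hw.reg _ rfl
    have hCh : w.reg rChoices = t * n :=
      ((hw.reg _ rfl).trans ((hv.reg _ rfl).trans (hu.reg _ rfl))).trans hs.regChoices
    have hG : w.reg rGo = 1 :=
      ((hw.reg _ rfl).trans ((hv.reg _ rfl).trans (hu.reg _ rfl))).trans hs.regGo
    rw [← hm'', ← hC''] at hP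
    rw [← repeats_past_iff] at hrep
    refine Runs.ite (fun h' => Runs.seq ?_) (fun h' => ?_)
    · rw [Expr.eval_reg, hrep] at h'
      refine (runs_finalChoice hn hset3.regN hset3.regM hnZ hmZ hP).mono fun x _ hx =>
        Runs.assign ⟨fun _ => ⟨by simp, ?_⟩, fun hns => absurd (.inr h') hns⟩
      rw [guidedExec, if_neg h, execCode_cons, Config.set_out, hx, ho'', ho', ho, hCh]
    · rw [Expr.eval_reg, ← not_ne_iff, hrep] at h'
      have hcur : w.reg rCur = 3 + Γ.code.length + t * (n * m) := by rw [hC'', hC', hC, hs.regCur]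
      refine (runs_iteration hset3 hnZ hmZ hL hP
        (by rw [hset3.regBase, hcur]; omega)).mono fun x hx ⟨h1, h2, h3, h4, h5⟩ =>
        ⟨fun hst => absurd hst (not_or.2 ⟨h, h'⟩), fun _ => ?_⟩
      have hmem : ∀ a < 3 + Γ.code.length + (t + 1) * (n * m), x.mem a = s.mem a := by
        intro a ha
        rw [h5 a (by rw [hcur]; rw [Nat.succ_mul] at ha; omega), hm'', hm', hm]
      refine ⟨hset3.frame hx rfl fun a ha => h5 a (by omega), by rw [h3, hT'', hT'],
        by rw [h2, hcur, Nat.succ_mul, Nat.add_assoc], by rw [h1, hCh, Nat.succ_mul],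
        (hx.reg _ rfl).trans hG, fun k hk => ?_, ?_⟩
      · rcases Nat.le_succ_iff.1 hk with hk | rfl
        · refine (hs.profiles k hk).congr fun a ha => hmem a ?_
          have := mul_add_le_mul (Nat.lt_succ_of_le hk) (n * m)
          rw [Nat.succ_eq_add_one] at this
          omega
        · rw [hcur, hCh, Nat.add_assoc, ← Nat.succ_mul] at h4
          exact h4
      · rw [hx.out rfl, ho'', ho', ho, past_succ]
  · rw [Expr.eval_reg, hun] at h
    refine ⟨by simp, ?_⟩
    rw [guidedExec, if_pos h, Config.set_out, ho', ho]
  · rw [Expr.eval_reg, hun] at h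
    exact absurd (.inl h) hns

/-! ### The input -/

theorem length_rowCode (J : Judgment m) : (rowCode J).length = m := by simp [rowCode]

theorem code_eq_flatMap (P : Profile n m) :
    Profile.code P = (List.finRange n).flatMap fun i => rowCode (P i) := rfl

theorem length_profileCode (P : Profile n m) : (Profile.code P).length = n * m := by
  simp [code_eq_flatMap, List.length_flatMap, length_rowCode]

theorem length_instanceCode (Γ : Formula m) (P : Profile n m) :
    (instanceCode Γ P).length = 3 + Γ.code.length + n * m := by
  simp [instanceCode, length_profileCode]
  omega

/-- Access to a concatenation of blocks of equal length. -/
theorem getElem?_flatMap {α : Type} {g : α → List ℕ} (hg : ∀ a, (g a).length = m) (l : List α)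
    (i : ℕ) {j : ℕ} (hj : j < m) :
    (l.flatMap g)[i * m + j]? = l[i]?.bind fun a => (g a)[j]? := by
  induction l generalizing i with
  | nil => simp
  | cons a l ih =>
    rw [List.flatMap_cons]
    cases i with
    | zero =>
      rw [List.getElem?_append_left (by rw [hg]; omega)]
      simp
    | succ i =>
      rw [List.getElem?_append_right (by rw [hg, Nat.succ_mul]; omega), hg,
        show (i + 1) * m + j - m = i * m + j by rw [Nat.succ_mul]; omega, ih]
      simp

theorem initial_profileAt (Γ : Formula m) (P : Profile n m) :
    ProfileAt (initial (instanceCode Γ P)).mem (3 + Γ.code.length) P := by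
  intro i φ
  simp only [initial, instanceCode, List.getD_eq_getElem?_getD]
  rw [List.getElem?_append_right (by simp; omega)]
  simp only [List.length_append, List.length_cons, List.length_nil]
  rw [show 3 + Γ.code.length + i * m + φ - (0 + 1 + 1 + 1 + Γ.code.length) = i * m + φ by omega,
    code_eq_flatMap, getElem?_flatMap (fun i => length_rowCode (P i)) _ _ φ.2]
  simp [rowCode]

theorem initial_listAt (Γ : Formula m) (P : Profile n m) :
    ListAt (initial (instanceCode Γ P)).mem 3 Γ.code := by
  intro k hk
  simp only [initial, instanceCode, List.getD_eq_getElem?_getD]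
  rw [List.getElem?_append_left (by simp; omega), List.getElem?_append_right (by simp)]
  simp [hk]

/-- Formulas contain at least one issue, since there are no propositional constants. Hence the
numbers `n` and `m` are at most `n * m`, and so at most the length of the input. -/
theorem Formula.pos_issues : ∀ {m : ℕ}, Formula m → 0 < m
  | _, .var φ => φ.pos
  | _, .neg A => A.pos_issues
  | _, .and A _ => A.pos_issues
  | _, .or A _ => A.pos_issues
  | _, .imp A _ => A.pos_issues

/-- The program writes the execution that is guided by the choice sequence. -/
theorem computesWithin_mainProg {T : ℕ} (hodd : Odd n) (hn : 0 < n)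
    (h0 : ∀ i, P₀ i ∈ rational Γ) (hT : StopsFirst Γ P₀ ω T) :
    ComputesWithin mainProg ω (instanceCode Γ P₀) (execCode (guidedExec Γ P₀ ω T hn))
      (mainProg.costPoly.eval (instanceCode Γ P₀).length) := by
  have hlen := length_instanceCode Γ P₀
  have hTle := hT.le hodd
  have hnm : n ≤ n * m := Nat.le_mul_of_pos_right n Γ.pos_issues
  have hmn : m ≤ n * m := Nat.le_mul_of_pos_left m hn
  -- Every loop runs over agents, issues, symbols of the formula or earlier profiles, except for the
  -- main loop with its `T + 1 ≤ n * m + 2` iterations; so the input length bounds them all.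
  set Z := (instanceCode Γ P₀).length with hZ
  suffices h : Runs ω Z mainProg (initial (instanceCode Γ P₀)) fun u =>
      u.out = execCode (guidedExec Γ P₀ ω T hn) by
    obtain ⟨s', c, h1, h2, h3⟩ := h
    exact ⟨s', c, h1, h3, h2⟩
  have hcode := initial_listAt Γ P₀
  have hprof := initial_profileAt Γ P₀
  have hreg : ∀ r, (initial (instanceCode Γ P₀)).reg r = 0 := fun _ => rfl
  have hout : (initial (instanceCode Γ P₀)).out = [] := rfl
  have hm0 : (initial (instanceCode Γ P₀)).mem 0 = n := rfl
  have hm1 : (initial (instanceCode Γ P₀)).mem 1 = m := rfl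
  have hm2 : (initial (instanceCode Γ P₀)).mem 2 = Γ.code.length := rfl
  generalize initial (instanceCode Γ P₀) = s at *
  refine Runs.seq (Runs.assign (Runs.seq (Runs.assign (Runs.seq (Runs.assign (Runs.seq
    (Runs.assign (Runs.seq ?_))))))))
  refine Runs.upto (N := n) (fun k u => u.reg rNM = k * m) (by simp [hm0]) (by omega) (by decide)
    (by simp) (fun k _ u hu _ hI => Runs.assign ?_) (fun u hu hI => ?_)
  · have hM : u.reg rM = m := by simpa [hm1] using hu.reg rM rfl
    simp [hI, hM, Nat.succ_mul]
  · have hN : u.reg rN = n := by simpa [hm0] using hu.reg rN rfl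
    have hM : u.reg rM = m := by simpa [hm1] using hu.reg rM rfl
    have hB : u.reg rBase = 3 + Γ.code.length := by simpa [hm2] using hu.reg rBase rfl
    have hTr : u.reg rT = 0 := by simpa [hreg] using hu.reg rT rfl
    have hCh : u.reg rChoices = 0 := by simpa [hreg] using hu.reg rChoices rfl
    have hmem : u.mem = s.mem := by simpa using hu.mem rfl
    have ho : u.out = s.out := by simpa using hu.out rfl
    refine Runs.seq (Runs.assign (Runs.seq (Runs.assign ?_)))
    -- One iteration of the loop for each of the times `0, …, T`.
    refine Runs.loop (N := T + 1) (by omega) (fun k v => (k ≤ T → AtTime Γ P₀ ω k v) ∧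
      (k = T + 1 → v.reg rGo = 0 ∧ v.out = execCode (guidedExec Γ P₀ ω T hn)))
      ⟨fun _ => ?_, by simp⟩ (fun k hk v _ hI' => ?_) (fun v _ hI' => ?_)
    · refine ⟨Setting.set (Setting.set ⟨hN, hM, hI, hB, ?_⟩ ?_) ?_, ?_, ?_, ?_, ?_, ?_, ?_⟩
      · rwa [hmem]
      · omega
      · omega
      · simp [hTr]
      · simp [hB]
      · simp [hCh]
      · simp
      · intro k hk
        obtain rfl : k = 0 := by omega
        simpa [hmem, trace] using hprof
      · simp [ho, hout, past, execCode]
    · have hat := hI'.1 (by omega)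
      refine ⟨by simp [hat.regGo], ?_⟩
      refine (runs_mainBody hn h0 (by omega) (by omega) (by omega) (by omega) hat).mono
        fun w _ ⟨h1, h2⟩ => ⟨fun hle => h2 (hT.2 k (by omega)), fun he => ?_⟩
      obtain rfl : k = T := by omega
      exact h1 hT.1
    · exact hI'.2 rfl

end Specs

end JudgAgg

/-- There are one program and one polynomial that work for all numbers of agents and issues, all
constraints and all initial profiles. Every execution of Algorithm 2, whatever is selected, can be
continued until it stops, has polynomially many iterations, and returns a consensus. The program
carries out Algorithm 2 in polynomial time: for any resolution `ω` of the choices it writes a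
complete execution, and every complete execution is obtained for some `ω`. -/
theorem mainTheorem6 :
    ∃ (prog : JudgAgg.Prog) (p : Polynomial ℕ),
      ∀ (n m : ℕ) (Γ : JudgAgg.Formula m) (P₀ : JudgAgg.Profile n m),
        Odd n → 3 < n →
        (∀ i, P₀ i ∈ JudgAgg.rational Γ) →
        JudgAgg.EpsConnected (JudgAgg.hammingGraph m) (JudgAgg.rational Γ) 1 P₀ →
        ¬ JudgAgg.Equidistant (JudgAgg.hammingGraph m) P₀ →
        (∀ P h, JudgAgg.PartialExec (JudgAgg.hammingGraph m) (JudgAgg.rational Γ) P₀ (P :: h) →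
          (P :: h).length ≤ p.eval (JudgAgg.instanceCode Γ P₀).length ∧
          (JudgAgg.Unanimous (JudgAgg.rational Γ) P ∨ JudgAgg.Repeats P h ∨
            ∃ Q, JudgAgg.PartialExec (JudgAgg.hammingGraph m) (JudgAgg.rational Γ) P₀
              (Q :: P :: h))) ∧
        (∀ ρ, JudgAgg.CompleteExec (JudgAgg.hammingGraph m) (JudgAgg.rational Γ) P₀ ρ →
          JudgAgg.ReachesConsensus (JudgAgg.rational Γ) ρ) ∧
        (∀ ω : ℕ → ℕ, ∃ ρ,
          JudgAgg.CompleteExec (JudgAgg.hammingGraph m) (JudgAgg.rational Γ) P₀ ρ ∧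
          JudgAgg.ComputesWithin prog ω (JudgAgg.instanceCode Γ P₀) (JudgAgg.execCode ρ)
            (p.eval (JudgAgg.instanceCode Γ P₀).length)) ∧
        (∀ ρ, JudgAgg.CompleteExec (JudgAgg.hammingGraph m) (JudgAgg.rational Γ) P₀ ρ →
          ∃ ω : ℕ → ℕ,
            JudgAgg.ComputesWithin prog ω (JudgAgg.instanceCode Γ P₀) (JudgAgg.execCode ρ)
              (p.eval (JudgAgg.instanceCode Γ P₀).length)) := by
  refine ⟨mainProg, mainProg.costPoly + Polynomial.X, fun n m Γ P₀ hodd h3 h0 _ _ => ?_⟩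
  have hn : 0 < n := by omega
  have hle : mainProg.costPoly.eval (instanceCode Γ P₀).length ≤
      (mainProg.costPoly + Polynomial.X).eval (instanceCode Γ P₀).length := by simp
  have hcomp : ∀ {ω T}, StopsFirst Γ P₀ ω T → ComputesWithin mainProg ω (instanceCode Γ P₀)
      (execCode (guidedExec Γ P₀ ω T hn))
      ((mainProg.costPoly + Polynomial.X).eval (instanceCode Γ P₀).length) := by
    intro ω T hT
    obtain ⟨s, c, h1, h2, h3⟩ := computesWithin_mainProg hodd hn h0 hT
    exact ⟨s, c, h1, h2, h3.trans hle⟩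
  refine ⟨fun P h hP => ⟨?_, ?_⟩, fun ρ hρ => hρ.reachesConsensus hn h0, fun ω => ?_,
    fun ρ hρ => ?_⟩
  · have := hP.length_le hodd
    rw [Polynomial.eval_add, Polynomial.eval_X, length_instanceCode]
    omega
  · by_cases hu : Unanimous (rational Γ) P
    · exact .inl hu
    by_cases hr : Repeats P h
    · exact .inr (.inl hr)
    obtain ⟨Q, hQ⟩ := exists_step (hammingGraph m) (rational Γ) P
    exact .inr (.inr ⟨Q, .step hP hu hr hQ⟩)
  · obtain ⟨T, hT⟩ := exists_stopsFirst hodd Γ P₀ ω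
    exact ⟨_, completeExec_guidedExec hT hn, hcomp hT⟩
  · obtain ⟨ω, T, hT, rfl⟩ := hρ.exists_guidedExec hn
    exact ⟨ω, hcomp hT⟩
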